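/- Let $d\ge 3$ and $r\ge 1$ be integers. For $f\colon[0,1]\to\mathbb R$ put $$\mathcal S_d[f](s)=\int_0^1 f(ts)\,\varrho_d(t)\,\mathrm dt,\quad s\in[0,1],\qquad \varrho_d(t)=\frac{2\Gamma(d/2)}{\sqrt\pi\,\Gamma((d-1)/2)}\,(1-t^2)^{\frac{d-3}{2}}.$$ Let $g_0=1$, $g_k(t)=\sqrt2\cos(\pi kt)$ for $k\ge1$, and for $a=(a_0,\dots,a_{K-1})\in\mathbb R^K$ let $f_a=\sum_{k=0}^{K-1}a_kg_k$. For an integer $n\ge 0$, $H^n$ of an interval denotes the Sobolev space of the functions whose weak derivatives up to order $n$ are in $L^2$, and $\|u\|_{H^1}^2=\|u\|_{L^2}^2+\|u'\|_{L^2}^2$. Assume that $F=\mathcal S_d[f]$ almost everywhere on $[0,1]$ for some $f\colon[0,1]\to\mathbb R$ with $f(|\cdot|)\in H^r([-1,1])$. Let $\mathcal H$ be $L^2([0,1])$ or $H^1([0,1])$. For every integer $K\ge1$ the problem $$\min_{a\in\mathbb R^K}\|\mathcal S_d[f_a]-F\|_{\mathcal H}^2$$ has a unique minimizer $a=a(K,\mathcal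 H)$, and $F-\mathcal S_d[f_a]\in\mathcal H$. Moreover: (i) If $\mathcal H=L^2([0,1])$, there is a constant $C>0$ independent of $K$ such that for all integers $K\ge1$ $$\|F-\mathcal S_d[f_a]\|_{L^2([0,1])}\le C\,K^{-\frac{r}{1+2r/(d-1)}}.$$ (ii) If $\mathcal H=H^1([0,1])$, there is a constant $C>0$ independent of $K$ such that for all integers $K\ge1$ $$\|F-\mathcal S_d[f_a]\|_{H^1([0,1])}\le C\,K^{-\frac{(r-1)(d-3)}{d-3+2r}}.$$ For $d>3$ the exponent in (ii) equals $-\frac{r-1}{1+2r/(d-3)}$; for $d=3$ it is $0$. -/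

import Mathlib

open MeasureTheory
open scoped ContDiff

noncomputable section

namespace Slicing

/-- The normalising constant `c_d = 2 Γ(d/2) / (√π Γ((d-1)/2))`. -/
def normConst (d : ℕ) : ℝ :=
  2 * Real.Gamma ((d : ℝ) / 2) / (Real.sqrt Real.pi * Real.Gamma (((d : ℝ) - 1) / 2))

/-- The density `ϱ_d(t) = c_d (1 - t²)^((d-3)/2)` on `[0,1]`. -/
def density (d : ℕ) (t : ℝ) : ℝ :=
  normConst d * (1 - t ^ 2) ^ (((d : ℝ) - 3) / 2)

/-- The slicing operator `S_d[f](s) = ∫₀¹ f(ts) ϱ_d(t) dt`. For `s ∈ [0,1]` it only involves the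
values of `f` on `[0,1]`. -/
def slicing (d : ℕ) (f : ℝ → ℝ) (s : ℝ) : ℝ :=
  ∫ t in (0 : ℝ)..1, f (t * s) * density d t

/-- The cosine basis `g_0 = 1`, `g_k(t) = √2 cos(π k t)` for `k ≥ 1`. -/
def cosBasis (k : ℕ) (t : ℝ) : ℝ :=
  if k = 0 then 1 else Real.sqrt 2 * Real.cos (Real.pi * k * t)

/-- The `K`-term cosine sum `f_a = ∑_{k=0}^{K-1} a_k g_k`. -/
def cosSum {K : ℕ} (a : Fin K → ℝ) (t : ℝ) : ℝ :=
  ∑ k : Fin K, a k * cosBasis k t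

/-- `v` is a `k`-th weak derivative of `u` on the open interval `(a,b)`. -/
def HasWeakDeriv (a b : ℝ) (k : ℕ) (u v : ℝ → ℝ) : Prop :=
  LocallyIntegrableOn u (Set.Ioo a b) ∧ LocallyIntegrableOn v (Set.Ioo a b) ∧
    ∀ φ : ℝ → ℝ, ContDiff ℝ ∞ φ → HasCompactSupport φ → tsupport φ ⊆ Set.Ioo a b →
      ∫ x in Set.Ioo a b, u x * iteratedDeriv k φ x =
        (-1) ^ k * ∫ x in Set.Ioo a b, v x * φ x

/-- `u ∈ H^n([a,b])`: `u` and its weak derivatives up to order `n` exist in `L²`. -/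
def MemSobolev (a b : ℝ) (n : ℕ) (u : ℝ → ℝ) : Prop :=
  MemLp u 2 (volume.restrict (Set.Ioo a b)) ∧
    ∀ k : ℕ, k ≤ n → ∃ v : ℝ → ℝ,
      MemLp v 2 (volume.restrict (Set.Ioo a b)) ∧ HasWeakDeriv a b k u v

open Classical in
/-- The first weak derivative on `(a,b)` (unique up to null sets); `0` if there is none. -/
def weakDeriv (a b : ℝ) (u : ℝ → ℝ) : ℝ → ℝ :=
  if h : ∃ v, HasWeakDeriv a b 1 u v then h.choose else 0

/-- The norm of `L²([0,1])` (meaningful for `u ∈ L²([0,1])`). -/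
def l2Norm (u : ℝ → ℝ) : ℝ :=
  Real.sqrt (∫ x in Set.Ioo (0 : ℝ) 1, u x ^ 2)

/-- The norm of `H¹([0,1])` (meaningful for `u ∈ H¹([0,1])`). -/
def h1Norm (u : ℝ → ℝ) : ℝ :=
  Real.sqrt ((∫ x in Set.Ioo (0 : ℝ) 1, u x ^ 2) +
    ∫ x in Set.Ioo (0 : ℝ) 1, weakDeriv 0 1 u x ^ 2)

/-- `a` solves `argmin_{a ∈ ℝ^K} ‖S_d[f_a] - F‖²` for the norm `N`. -/
def IsMinimizer (N : (ℝ → ℝ) → ℝ) (d : ℕ) (F : ℝ → ℝ) {K : ℕ} (a : Fin K → ℝ) : Prop :=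
  ∀ b : Fin K → ℝ,
    N (fun s => slicing d (cosSum a) s - F s) ^ 2 ≤
      N (fun s => slicing d (cosSum b) s - F s) ^ 2

end Slicing

end

/-!
Extend `f` evenly, so that `u = f |·|` lies in `H^r(-1, 1)`. The extension need not be periodic
with its derivatives, so its cosine series may converge slowly; but multiplying `u` by a smooth
cutoff which vanishes near `±1` and equals `1` on `[-(1 - ε), 1 - ε]` makes it periodic, at the cost
of a factor `ε⁻¹ ^ r` in the norm of the `r`-th derivative. By Parseval's identity the partial
cosine sums of the product converge in `L²` at rate `ε⁻¹ ^ r * K ^ (-r)`, their derivatives at rate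
`ε⁻¹ ^ r * K ^ (-(r - 1))`.

Slicing hardly notices the modification: if `g` vanishes on `(0, 1 - ε)`, then only `t ∈ (1 - ε, 1)`
contribute to `S_d[g](s)` for `s < 1`, and there the density is at most a constant times
`ε ^ ((d - 3) / 2)`, so that `‖S_d[g]‖ ≤ C * ε ^ ((d - 1) / 2) * ‖g‖`. As `(S_d[g])'(s)` is the
average of `g'(t s)` with the weight `t * ϱ_d(t)`, the same bound holds for derivatives, where
`‖g'‖` is of order `ε⁻¹`. Balancing the two errors over `ε` gives both rates.

Minimizers exist and are unique because the functions `S_d[g_k]` are linearly independent: if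
`S_d` maps an even trigonometric polynomial to `0`, its derivatives of all orders vanish at `0`,
since the moments of `ϱ_d` are positive.
-/

noncomputable section

namespace Slicing

open Set ENNReal

/-- The average `∫₀¹ g(ts) w(t) dt` of the dilates of `g` with weight `w`: the slicing operator
without a choice of the weight. -/
def dilAvg (w g : ℝ → ℝ) (s : ℝ) : ℝ := ∫ t in (0 : ℝ)..1, g (t * s) * w t

/-- Lebesgue measure on the open unit interval. -/
abbrev unitVol : Measure ℝ := volume.restrict (Ioo (0 : ℝ) 1)

lemma dilAvg_eq_setIntegral (w g : ℝ → ℝ) (s : ℝ) :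
    dilAvg w g s = ∫ t, g (t * s) * w t ∂unitVol := by
  rw [dilAvg, intervalIntegral.integral_of_le zero_le_one, integral_Ioc_eq_integral_Ioo]

lemma map_mul_unitVol_le {s : ℝ} (hs : s ∈ Ioo (0 : ℝ) 1) :
    Measure.map (· * s) unitVol ≤ ENNReal.ofReal s⁻¹ • unitVol := by
  have hpre : (· * s) ⁻¹' Ioo 0 s = Ioo (0 : ℝ) 1 := by
    rw [Set.preimage_mul_const_Ioo₀ _ _ hs.1, zero_div, div_self hs.1.ne']
  rw [unitVol, ← hpre, ← Measure.restrict_map (by fun_prop) measurableSet_Ioo,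
    Real.map_volume_mul_right hs.1.ne', Measure.restrict_smul, hpre, abs_of_pos (inv_pos.2 hs.1)]
  gcongr
  exact hs.2.le

lemma ae_comp_mul {p : ℝ → Prop} (h : ∀ᵐ x ∂unitVol, p x) {s : ℝ} (hs : s ∈ Ioo (0 : ℝ) 1) :
    ∀ᵐ t ∂unitVol, p (t * s) :=
  ae_of_ae_map (by fun_prop) <| Measure.ae_mono'
    ((Measure.absolutelyContinuous_of_le (map_mul_unitVol_le hs)).trans
      Measure.smul_absolutelyContinuous) h

lemma dilAvg_congr {w g g' : ℝ → ℝ} (h : g =ᵐ[unitVol] g') {s : ℝ} (hs : s ∈ Ioo (0 : ℝ) 1) :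
    dilAvg w g s = dilAvg w g' s := by
  rw [dilAvg_eq_setIntegral, dilAvg_eq_setIntegral]
  refine integral_congr_ae ?_
  filter_upwards [ae_comp_mul h hs] with t ht
  rw [ht]

lemma memLp_comp_mul {g : ℝ → ℝ} {p : ℝ≥0∞} (hg : MemLp g p unitVol) {s : ℝ}
    (hs : s ∈ Ioo (0 : ℝ) 1) : MemLp (fun t => g (t * s)) p unitVol :=
  (hg.of_measure_le_smul ENNReal.ofReal_ne_top (map_mul_unitVol_le hs)).comp_of_map (by fun_prop)

lemma lintegral_comp_mul_le (φ : ℝ → ℝ≥0∞) {s : ℝ} (hs : s ∈ Ioo (0 : ℝ) 1) :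
    ∫⁻ t, φ (t * s) ∂unitVol ≤ ENNReal.ofReal s⁻¹ * ∫⁻ x, φ x ∂unitVol := by
  have he : MeasurableEmbedding (fun t : ℝ => t * s) :=
    (Homeomorph.mulRight₀ s hs.1.ne').measurableEmbedding
  calc ∫⁻ t, φ (t * s) ∂unitVol
    _ = ∫⁻ x, φ x ∂Measure.map (· * s) unitVol := (he.lintegral_map ..).symm
    _ ≤ ∫⁻ x, φ x ∂(ENNReal.ofReal s⁻¹ • unitVol) :=
        lintegral_mono' (map_mul_unitVol_le hs) le_rfl
    _ = ENNReal.ofReal s⁻¹ * ∫⁻ x, φ x ∂unitVol := lintegral_smul_measure ..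

lemma sq_lintegral_mul_le {α : Type*} [MeasurableSpace α] (μ : Measure α) {f g : α → ℝ≥0∞}
    (hf : AEMeasurable f μ) (hg : AEMeasurable g μ) :
    (∫⁻ a, f a * g a ∂μ) ^ 2 ≤ (∫⁻ a, f a ^ 2 ∂μ) * ∫⁻ a, g a ^ 2 ∂μ := by
  have h := pow_le_pow_left₀ zero_le
    (ENNReal.lintegral_mul_le_Lp_mul_Lq μ Real.HolderConjugate.two_two hf hg) 2
  simp only [Pi.mul_apply, ENNReal.rpow_two] at h
  refine h.trans (le_of_eq ?_)
  rw [mul_pow]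
  congr 1 <;> rw [← ENNReal.rpow_two, ← ENNReal.rpow_mul] <;> norm_num

lemma sq_lintegral_le_mul_lintegral_rpow {ν : Measure ℝ} (hν : ∀ᵐ t ∂ν, 0 < t) {ψ : ℝ → ℝ≥0∞}
    (hψ : Measurable ψ) (a : ℝ) :
    (∫⁻ t, ψ t ∂ν) ^ 2 ≤ (∫⁻ t, ENNReal.ofReal (t ^ (-a)) ∂ν) *
      ∫⁻ t, ψ t ^ 2 * ENNReal.ofReal (t ^ a) ∂ν := by
  have hsq : ∀ {t : ℝ}, 0 < t → ∀ b : ℝ,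
      ENNReal.ofReal (t ^ (b / 2)) ^ 2 = ENNReal.ofReal (t ^ b) := by
    intro t ht b
    rw [← ENNReal.ofReal_pow (by positivity), ← Real.rpow_natCast, ← Real.rpow_mul ht.le]
    norm_num
  have hsplit : ∫⁻ t, ψ t ∂ν = ∫⁻ t, ENNReal.ofReal (t ^ (-a / 2)) *
      (ψ t * ENNReal.ofReal (t ^ (a / 2))) ∂ν := by
    refine lintegral_congr_ae ?_
    filter_upwards [hν] with t ht
    rw [mul_left_comm, ← ENNReal.ofReal_mul (by positivity), ← Real.rpow_add ht]
    simp [neg_div]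
  rw [hsplit]
  refine (sq_lintegral_mul_le ν (by fun_prop) (by fun_prop)).trans (le_of_eq ?_)
  congr 1 <;> refine lintegral_congr_ae ?_ <;> filter_upwards [hν] with t ht
  · rw [hsq ht]
  · rw [mul_pow, hsq ht]

/-- Cauchy–Schwarz with the weights `t ^ (-1/2)` and `t ^ (1/2)`, then Tonelli. -/
lemma lintegral_sq_lintegral_comp_mul_le_of_measurable {ν : Measure ℝ} [SFinite ν]
    (hν : ∀ᵐ t ∂ν, t ∈ Ioo (0 : ℝ) 1) {φ : ℝ → ℝ≥0∞} (hφ : Measurable φ) :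
    ∫⁻ s, (∫⁻ t, φ (t * s) ∂ν) ^ 2 ∂unitVol ≤
      (∫⁻ t, ENNReal.ofReal (t ^ (-(1 / 2) : ℝ)) ∂ν) ^ 2 * ∫⁻ x, φ x ^ 2 ∂unitVol := by
  set G := ∫⁻ x, φ x ^ 2 ∂unitVol
  set J := ∫⁻ t, ENNReal.ofReal (t ^ (-(1 / 2) : ℝ)) ∂ν
  have hmeas : Measurable (Function.uncurry fun s t : ℝ =>
      φ (t * s) ^ 2 * ENNReal.ofReal (t ^ (1 / 2 : ℝ))) := by
    unfold Function.uncurry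
    fun_prop
  have hdil : ∀ t ∈ Ioo (0 : ℝ) 1, ∫⁻ s, φ (t * s) ^ 2 * ENNReal.ofReal (t ^ (1 / 2 : ℝ)) ∂unitVol ≤
      ENNReal.ofReal (t ^ (-(1 / 2) : ℝ)) * G := by
    intro t ht
    have h := lintegral_comp_mul_le (fun x => φ x ^ 2) ht
    simp only [mul_comm _ t] at h
    rw [lintegral_mul_const _ (by fun_prop)]
    calc (∫⁻ s, φ (t * s) ^ 2 ∂unitVol) * ENNReal.ofReal (t ^ (1 / 2 : ℝ)) ≤
          ENNReal.ofReal t⁻¹ * G * ENNReal.ofReal (t ^ (1 / 2 : ℝ)) := by gcongr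
      _ = ENNReal.ofReal (t ^ (-(1 / 2) : ℝ)) * G := by
        rw [mul_right_comm, ← ENNReal.ofReal_mul (inv_nonneg.2 ht.1.le), ← Real.rpow_neg_one,
          ← Real.rpow_add ht.1]
        norm_num
  calc ∫⁻ s, (∫⁻ t, φ (t * s) ∂ν) ^ 2 ∂unitVol
      ≤ ∫⁻ s, J * ∫⁻ t, φ (t * s) ^ 2 * ENNReal.ofReal (t ^ (1 / 2 : ℝ)) ∂ν ∂unitVol :=
        lintegral_mono fun s =>
          sq_lintegral_le_mul_lintegral_rpow (hν.mono fun _ ht => ht.1) (by fun_prop) _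
    _ = J * ∫⁻ t, ∫⁻ s, φ (t * s) ^ 2 * ENNReal.ofReal (t ^ (1 / 2 : ℝ)) ∂unitVol ∂ν := by
        rw [lintegral_const_mul _ (by exact hmeas.lintegral_prod_right),
          lintegral_lintegral_swap hmeas.aemeasurable]
    _ ≤ J * ∫⁻ t, ENNReal.ofReal (t ^ (-(1 / 2) : ℝ)) * G ∂ν := by
        gcongr J * ?_
        exact lintegral_mono_ae (hν.mono hdil)
    _ = J ^ 2 * G := by rw [lintegral_mul_const _ (by fun_prop)]; ring

lemma lintegral_sq_lintegral_comp_mul_le {ν : Measure ℝ} [SFinite ν] (hν : ν ≪ unitVol)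
    {φ : ℝ → ℝ≥0∞} (hφ : AEMeasurable φ unitVol) :
    ∫⁻ s, (∫⁻ t, φ (t * s) ∂ν) ^ 2 ∂unitVol ≤
      (∫⁻ t, ENNReal.ofReal (t ^ (-(1 / 2) : ℝ)) ∂ν) ^ 2 * ∫⁻ x, φ x ^ 2 ∂unitVol := by
  have h := lintegral_sq_lintegral_comp_mul_le_of_measurable
    (hν.ae_le (ae_restrict_mem measurableSet_Ioo)) hφ.measurable_mk
  have hinner : ∀ s ∈ Ioo (0 : ℝ) 1, (∫⁻ t, φ (t * s) ∂ν) ^ 2 = (∫⁻ t, hφ.mk φ (t * s) ∂ν) ^ 2 :=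
    fun s hs => by rw [lintegral_congr_ae (hν.ae_le (ae_comp_mul hφ.ae_eq_mk hs))]
  have houter : ∫⁻ x, φ x ^ 2 ∂unitVol = ∫⁻ x, hφ.mk φ x ^ 2 ∂unitVol :=
    lintegral_congr_ae (hφ.ae_eq_mk.mono fun x hx => by simp only [hx])
  rwa [setLIntegral_congr_fun measurableSet_Ioo hinner, houter]

lemma ofReal_integral_sq {α : Type*} [MeasurableSpace α] {μ : Measure α} {u : α → ℝ}
    (hu : MemLp u 2 μ) : ENNReal.ofReal (∫ x, u x ^ 2 ∂μ) = ∫⁻ x, ‖u x‖ₑ ^ 2 ∂μ := by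
  rw [ofReal_integral_eq_lintegral_ofReal hu.integrable_sq (ae_of_all _ fun x => sq_nonneg _)]
  refine lintegral_congr fun x => ?_
  rw [← sq_abs, ENNReal.ofReal_pow (abs_nonneg _), ← ofReal_norm, Real.norm_eq_abs]

lemma memLp_two_of_lintegral_sq {α E : Type*} [MeasurableSpace α] [NormedAddCommGroup E]
    {μ : Measure α} {u : α → E}
    (hu : AEStronglyMeasurable u μ) (h : ∫⁻ x, ‖u x‖ₑ ^ 2 ∂μ < ⊤) : MemLp u 2 μ := by
  refine ⟨hu, ?_⟩
  rw [eLpNorm_lt_top_iff_lintegral_rpow_enorm_lt_top two_ne_zero ENNReal.ofNat_ne_top]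
  simpa using h

lemma setLIntegral_rpow_neg_half_le {ε : ℝ} (hε : 0 ≤ ε) (hε1 : ε ≤ 1) :
    ∫⁻ t in Ioo (1 - ε) 1, ENNReal.ofReal (t ^ (-(1 / 2) : ℝ)) ≤ ENNReal.ofReal (2 * ε) := by
  have h_int : IntegrableOn (fun t : ℝ => t ^ (-(1 / 2) : ℝ)) (Ioc (1 - ε) 1) :=
    (intervalIntegrable_iff_integrableOn_Ioc_of_le (by linarith)).1
      (intervalIntegral.intervalIntegrable_rpow' (by norm_num))
  have hval : ∫ t in Ioo (1 - ε) 1, t ^ (-(1 / 2) : ℝ) = 2 * (1 - √(1 - ε)) := by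
    rw [← integral_Ioc_eq_integral_Ioo, ← intervalIntegral.integral_of_le (by linarith),
      integral_rpow (Or.inl (by norm_num)), Real.sqrt_eq_rpow]
    norm_num
    ring
  rw [← ofReal_integral_eq_lintegral_ofReal (h_int.mono_set Ioo_subset_Ioc_self)
    ((ae_restrict_iff' measurableSet_Ioo).2 (ae_of_all _ fun t ht =>
      Real.rpow_nonneg (by linarith [ht.1]) _)), hval]
  have : 1 - ε ≤ √(1 - ε) := Real.le_sqrt_of_sq_le (by nlinarith)
  exact ENNReal.ofReal_le_ofReal (by linarith)

lemma enorm_dilAvg_le {w g : ℝ → ℝ} {M ε : ℝ} (hw : ∀ t ∈ Ioo (1 - ε) 1, |w t| ≤ M)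
    (hg : ∀ x ∈ Ioo 0 (1 - ε), g x = 0) {s : ℝ} (hs : s ∈ Ioo (0 : ℝ) 1) :
    ‖dilAvg w g s‖ₑ ≤ ENNReal.ofReal M * ∫⁻ t in Ioo (1 - ε) 1, ‖g (t * s)‖ₑ := by
  have hind : ∀ᵐ t, (Ioo 0 1).indicator (fun t => ‖g (t * s) * w t‖ₑ) t ≤
      (Ioo (1 - ε) 1).indicator (fun t => ENNReal.ofReal M * ‖g (t * s)‖ₑ) t := by
    filter_upwards [Measure.ae_ne volume (1 - ε)] with t htδ
    by_cases ht : t ∈ Ioo (0 : ℝ) 1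
    · rw [indicator_of_mem ht]
      rcases lt_or_gt_of_ne htδ with h | h
      · rw [hg (t * s) ⟨mul_pos ht.1 hs.1, by nlinarith [ht.1, hs.2]⟩]
        simp
      · rw [indicator_of_mem (show t ∈ Ioo (1 - ε) 1 from ⟨h, ht.2⟩), enorm_mul, mul_comm,
          Real.enorm_eq_ofReal_abs (w t)]
        gcongr
        exact hw t ⟨h, ht.2⟩
    · simp [indicator_of_notMem ht]
  rw [dilAvg_eq_setIntegral]
  refine (enorm_integral_le_lintegral_enorm _).trans ?_
  rw [← lintegral_const_mul' _ _ ENNReal.ofReal_ne_top, ← lintegral_indicator measurableSet_Ioo,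
    ← lintegral_indicator measurableSet_Ioo]
  exact lintegral_mono_ae hind

lemma lintegral_dilAvg_sq_le {w g : ℝ → ℝ} (hgm : AEStronglyMeasurable g unitVol) {M ε : ℝ}
    (hε : 0 ≤ ε) (hε1 : ε ≤ 1) (hw : ∀ t ∈ Ioo (1 - ε) 1, |w t| ≤ M)
    (hg : ∀ x ∈ Ioo 0 (1 - ε), g x = 0) :
    ∫⁻ s, ‖dilAvg w g s‖ₑ ^ 2 ∂unitVol ≤
      (ENNReal.ofReal M * ENNReal.ofReal (2 * ε)) ^ 2 * ∫⁻ x, ‖g x‖ₑ ^ 2 ∂unitVol := by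
  set ν := volume.restrict (Ioo (1 - ε) 1)
  have hν : ν ≪ unitVol :=
    (Measure.restrict_mono (Ioo_subset_Ioo_left (by linarith)) le_rfl).absolutelyContinuous
  calc ∫⁻ s, ‖dilAvg w g s‖ₑ ^ 2 ∂unitVol
      ≤ ∫⁻ s, ENNReal.ofReal M ^ 2 * (∫⁻ t, ‖g (t * s)‖ₑ ∂ν) ^ 2 ∂unitVol :=
        setLIntegral_mono' measurableSet_Ioo fun s hs => by
          rw [← mul_pow]
          gcongr
          exact enorm_dilAvg_le hw hg hs
    _ = ENNReal.ofReal M ^ 2 * ∫⁻ s, (∫⁻ t, ‖g (t * s)‖ₑ ∂ν) ^ 2 ∂unitVol :=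
        lintegral_const_mul' _ _ (by finiteness)
    _ ≤ ENNReal.ofReal M ^ 2 * (ENNReal.ofReal (2 * ε) ^ 2 * ∫⁻ x, ‖g x‖ₑ ^ 2 ∂unitVol) := by
        gcongr
        refine (lintegral_sq_lintegral_comp_mul_le hν hgm.enorm).trans ?_
        gcongr
        exact setLIntegral_rpow_neg_half_le hε hε1
    _ = _ := by ring

lemma aestronglyMeasurable_dilAvg {w g : ℝ → ℝ} (hw : AEStronglyMeasurable w unitVol)
    (hg : AEStronglyMeasurable g unitVol) : AEStronglyMeasurable (dilAvg w g) unitVol := by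
  have hm : StronglyMeasurable fun s => ∫ t, hg.mk g (t * s) * hw.mk w t ∂unitVol := by
    have : Measurable (hg.mk g) := hg.stronglyMeasurable_mk.measurable
    have : Measurable (hw.mk w) := hw.stronglyMeasurable_mk.measurable
    exact (show Measurable (Function.uncurry fun s t : ℝ => hg.mk g (t * s) * hw.mk w t) by
      unfold Function.uncurry; fun_prop).stronglyMeasurable.integral_prod_right
  refine ⟨_, hm, ?_⟩
  filter_upwards [ae_restrict_mem measurableSet_Ioo] with s hs
  rw [dilAvg_congr hg.ae_eq_mk hs, dilAvg_eq_setIntegral]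
  exact integral_congr_ae (hw.ae_eq_mk.mono fun t ht => by simp only [ht])

lemma exists_abs_le_of_continuous {w : ℝ → ℝ} (hw : Continuous w) :
    ∃ M, ∀ t ∈ Ioo (0 : ℝ) 1, |w t| ≤ M :=
  let ⟨M, hM⟩ := isCompact_Icc.exists_bound_of_continuousOn hw.continuousOn
  ⟨M, fun t ht => hM t (Ioo_subset_Icc_self ht)⟩

section DilationBounds

variable {w g g' : ℝ → ℝ}

lemma memLp_dilAvg (hw : Continuous w) (hg : MemLp g 2 unitVol) : MemLp (dilAvg w g) 2 unitVol := by
  obtain ⟨M, hM⟩ := exists_abs_le_of_continuous hw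
  refine memLp_two_of_lintegral_sq (aestronglyMeasurable_dilAvg hw.aestronglyMeasurable hg.1) ?_
  refine (lintegral_dilAvg_sq_le (M := M) (ε := 1) hg.1 zero_le_one le_rfl
    (by simpa using hM) (by simp)).trans_lt ?_
  rw [← ofReal_integral_sq hg]
  finiteness

lemma integral_dilAvg_sq_le (hw : Continuous w) (hg : MemLp g 2 unitVol) {M ε : ℝ}
    (hε : 0 < ε) (hε1 : ε ≤ 1) (hM : ∀ t ∈ Ioo (1 - ε) 1, |w t| ≤ M)
    (hg0 : ∀ x ∈ Ioo 0 (1 - ε), g x = 0) :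
    ∫ s, dilAvg w g s ^ 2 ∂unitVol ≤ (2 * M * ε) ^ 2 * ∫ x, g x ^ 2 ∂unitVol := by
  have hM0 : 0 ≤ M := (abs_nonneg _).trans (hM (1 - ε / 2) ⟨by linarith, by linarith⟩)
  have h := lintegral_dilAvg_sq_le hg.1 hε.le hε1 hM hg0
  rw [← ofReal_integral_sq hg, ← ofReal_integral_sq (memLp_dilAvg hw hg), ← ENNReal.ofReal_mul hM0,
    ← ENNReal.ofReal_pow (by positivity), ← ENNReal.ofReal_mul (by positivity)] at h
  exact ((ENNReal.ofReal_le_ofReal_iff (mul_nonneg (by positivity)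
    (integral_nonneg fun x => sq_nonneg _))).1 h).trans_eq (by ring)

lemma integrable_comp_mul_mul (hw : Continuous w) (hg : Integrable g unitVol) {s : ℝ}
    (hs : s ∈ Ioo (0 : ℝ) 1) : Integrable (fun t => g (t * s) * w t) unitVol := by
  obtain ⟨M, hM⟩ := exists_abs_le_of_continuous hw
  rw [← memLp_one_iff_integrable] at hg
  exact (memLp_one_iff_integrable.1 (memLp_comp_mul hg hs)).mul_bdd (c := M)
    hw.aestronglyMeasurable ((ae_restrict_mem measurableSet_Ioo).mono hM)

lemma dilAvg_sub (hw : Continuous w) (hg : Integrable g unitVol) (hg' : Integrable g' unitVol)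
    {s : ℝ} (hs : s ∈ Ioo (0 : ℝ) 1) :
    dilAvg w (fun x => g x - g' x) s = dilAvg w g s - dilAvg w g' s := by
  simp only [dilAvg_eq_setIntegral, sub_mul]
  exact integral_sub (integrable_comp_mul_mul hw hg hs) (integrable_comp_mul_mul hw hg' hs)

lemma dilAvg_sum {ι : Type*} (S : Finset ι) (hw : Continuous w) (c : ι → ℝ) {G : ι → ℝ → ℝ}
    (hG : ∀ i ∈ S, Continuous (G i)) (s : ℝ) :
    dilAvg w (fun x => ∑ i ∈ S, c i * G i x) s = ∑ i ∈ S, c i * dilAvg w (G i) s := by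
  simp only [dilAvg, ← intervalIntegral.integral_const_mul, Finset.sum_mul, mul_assoc]
  refine intervalIntegral.integral_finsetSum fun i hi => Continuous.intervalIntegrable ?_ _ _
  have := hG i hi
  fun_prop

end DilationBounds

section WeakDerivative

variable {a b : ℝ} {k : ℕ} {u u' v v' φ : ℝ → ℝ}

lemma locallyIntegrableOn_of_memLp {p : ℝ≥0∞} (hp : 1 ≤ p)
    (hu : MemLp u p (volume.restrict (Ioo a b))) : LocallyIntegrableOn u (Ioo a b) :=
  IntegrableOn.locallyIntegrableOn (hu.integrable hp)

lemma memLp_Ioo_of_continuous {p : ℝ≥0∞} (hu : Continuous u) :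
    MemLp u p (volume.restrict (Ioo a b)) := by
  obtain ⟨C, hC⟩ := (isCompact_Icc (a := a) (b := b)).exists_bound_of_continuousOn hu.continuousOn
  exact MemLp.of_bound hu.aestronglyMeasurable C
    ((ae_restrict_mem measurableSet_Ioo).mono fun x hx => hC x (Ioo_subset_Icc_self hx))

lemma memLp_continuous_mul {p : ℝ≥0∞} (hv : MemLp v p (volume.restrict (Ioo a b)))
    (hu : Continuous u) : MemLp (fun x => u x * v x) p (volume.restrict (Ioo a b)) :=
  hv.mul (p := ∞) (memLp_Ioo_of_continuous hu)

lemma tsupport_iteratedDeriv_subset (k : ℕ) (φ : ℝ → ℝ) :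
    tsupport (iteratedDeriv k φ) ⊆ tsupport φ := by
  induction k with
  | zero => simp
  | succ k ih => rw [iteratedDeriv_succ]; exact tsupport_deriv_subset.trans ih

lemma integrableOn_mul_of_tsupport_subset (hu : LocallyIntegrableOn u (Ioo a b))
    (hφ : Continuous φ) (hφc : HasCompactSupport φ) (hφs : tsupport φ ⊆ Ioo a b) :
    IntegrableOn (fun x => u x * φ x) (Ioo a b) := by
  have h : IntegrableOn (fun x => u x * φ x) (tsupport φ) :=
    ((hu.mono_set hφs).integrableOn_isCompact hφc).mul_continuousOn hφ.continuousOn hφc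
  exact ((integrableOn_iff_integrable_of_support_subset
    ((Function.support_mul_subset_right u φ).trans (subset_tsupport φ))).1 h).integrableOn

lemma setIntegral_mul_eq_integral_of_tsupport_subset {S : Set ℝ} (h : tsupport φ ⊆ S)
    (u : ℝ → ℝ) : ∫ x in S, u x * φ x = ∫ x, u x * φ x :=
  setIntegral_eq_integral_of_forall_compl_eq_zero fun x hx => by
    rw [image_eq_zero_of_notMem_tsupport (fun h' => hx (h h')), mul_zero]

lemma HasWeakDeriv.sub (h : HasWeakDeriv a b k u v) (h' : HasWeakDeriv a b k u' v') :
    HasWeakDeriv a b k (fun x => u x - u' x) (fun x => v x - v' x) := by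
  refine ⟨h.1.sub h'.1, h.2.1.sub h'.2.1, fun φ hφ hφc hφs => ?_⟩
  have hd : Continuous (iteratedDeriv k φ) :=
    hφ.continuous_iteratedDeriv k (by exact_mod_cast le_top)
  have hds := (tsupport_iteratedDeriv_subset k φ).trans hφs
  have hdc : HasCompactSupport (iteratedDeriv k φ) :=
    hφc.of_isClosed_subset (isClosed_tsupport _) (tsupport_iteratedDeriv_subset k φ)
  simp only [sub_mul]
  rw [integral_sub (integrableOn_mul_of_tsupport_subset h.1 hd hdc hds)
      (integrableOn_mul_of_tsupport_subset h'.1 hd hdc hds),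
    integral_sub (integrableOn_mul_of_tsupport_subset h.2.1 hφ.continuous hφc hφs)
      (integrableOn_mul_of_tsupport_subset h'.2.1 hφ.continuous hφc hφs),
    h.2.2 φ hφ hφc hφs, h'.2.2 φ hφ hφc hφs, mul_sub]

lemma HasWeakDeriv.ae_eq (h : HasWeakDeriv a b k u v) (h' : HasWeakDeriv a b k u v') :
    v =ᵐ[volume.restrict (Ioo a b)] v' := by
  have hzero : ∀ᵐ x, x ∈ Ioo a b → v x - v' x = 0 := by
    refine isOpen_Ioo.ae_eq_zero_of_integral_contDiff_smul_eq_zero (h.2.1.sub h'.2.1)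
      fun φ hφ hφc hφs => ?_
    have hsub := (h.sub h').2.2 φ hφ hφc hφs
    simp only [sub_self, zero_mul, integral_zero] at hsub
    have := (mul_eq_zero.1 hsub.symm).resolve_left (pow_ne_zero k (by norm_num))
    simp only [smul_eq_mul, mul_comm (φ _)]
    rwa [setIntegral_mul_eq_integral_of_tsupport_subset hφs] at this
  exact (ae_restrict_iff' measurableSet_Ioo).2 (hzero.mono fun x hx hxI => sub_eq_zero.1 (hx hxI))

lemma weakDeriv_ae_eq (h : HasWeakDeriv a b 1 u v) :
    weakDeriv a b u =ᵐ[volume.restrict (Ioo a b)] v := by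
  have hex : ∃ v, HasWeakDeriv a b 1 u v := ⟨v, h⟩
  rw [weakDeriv, dif_pos hex]
  exact hex.choose_spec.ae_eq h

/-- `u` and its weak derivative `v` are both in `L²(a,b)`: a member of `H¹(a,b)` together with its
weak derivative. -/
structure HasL2WeakDeriv (a b : ℝ) (u v : ℝ → ℝ) : Prop where
  memLp : MemLp u 2 (volume.restrict (Ioo a b))
  memLp_deriv : MemLp v 2 (volume.restrict (Ioo a b))
  hasWeakDeriv : HasWeakDeriv a b 1 u v

lemma hasL2WeakDeriv_iff : HasL2WeakDeriv a b u v ↔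
    MemLp u 2 (volume.restrict (Ioo a b)) ∧ MemLp v 2 (volume.restrict (Ioo a b)) ∧
      ∀ φ : ℝ → ℝ, ContDiff ℝ ∞ φ → HasCompactSupport φ → tsupport φ ⊆ Ioo a b →
        ∫ x in Ioo a b, u x * deriv φ x = -∫ x in Ioo a b, v x * φ x := by
  refine ⟨fun h => ⟨h.memLp, h.memLp_deriv, fun φ hφ hφc hφs => ?_⟩, fun ⟨hu, hv, h⟩ => ⟨hu, hv,
    locallyIntegrableOn_of_memLp one_le_two hu, locallyIntegrableOn_of_memLp one_le_two hv,
    fun φ hφ hφc hφs => ?_⟩⟩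
  · simpa using h.hasWeakDeriv.2.2 φ hφ hφc hφs
  · simpa using h φ hφ hφc hφs

namespace HasL2WeakDeriv

lemma integral_mul_deriv (h : HasL2WeakDeriv a b u v) (hφ : ContDiff ℝ ∞ φ)
    (hφc : HasCompactSupport φ) (hφs : tsupport φ ⊆ Ioo a b) :
    ∫ x in Ioo a b, u x * deriv φ x = -∫ x in Ioo a b, v x * φ x :=
  (hasL2WeakDeriv_iff.1 h).2.2 φ hφ hφc hφs

lemma sub (h : HasL2WeakDeriv a b u v) (h' : HasL2WeakDeriv a b u' v') :
    HasL2WeakDeriv a b (fun x => u x - u' x) (fun x => v x - v' x) :=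
  ⟨h.memLp.sub h'.memLp, h.memLp_deriv.sub h'.memLp_deriv, h.hasWeakDeriv.sub h'.hasWeakDeriv⟩

lemma congr (h : HasL2WeakDeriv a b u v) (hu : u =ᵐ[volume.restrict (Ioo a b)] u')
    (hv : v =ᵐ[volume.restrict (Ioo a b)] v') : HasL2WeakDeriv a b u' v' := by
  refine hasL2WeakDeriv_iff.2 ⟨h.memLp.ae_eq hu, h.memLp_deriv.ae_eq hv, fun φ hφ hφc hφs => ?_⟩
  calc ∫ x in Ioo a b, u' x * deriv φ x = ∫ x in Ioo a b, u x * deriv φ x :=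
        integral_congr_ae (hu.mono fun x hx => by simp only [hx])
    _ = -∫ x in Ioo a b, v x * φ x := h.integral_mul_deriv hφ hφc hφs
    _ = -∫ x in Ioo a b, v' x * φ x := by
        rw [integral_congr_ae (hv.mono fun x hx => show v x * φ x = v' x * φ x by rw [hx])]

lemma mono {a' b' : ℝ} (h : HasL2WeakDeriv a b u v) (ha : a ≤ a') (hb : b' ≤ b) :
    HasL2WeakDeriv a' b' u v := by
  have hsub : Ioo a' b' ⊆ Ioo a b := Ioo_subset_Ioo ha hb
  have hμ : volume.restrict (Ioo a' b') ≤ volume.restrict (Ioo a b) :=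
    Measure.restrict_mono hsub le_rfl
  refine hasL2WeakDeriv_iff.2 ⟨h.memLp.mono_measure hμ, h.memLp_deriv.mono_measure hμ,
    fun φ hφ hφc hφs => ?_⟩
  have hds := (tsupport_deriv_subset (f := φ)).trans hφs
  rw [setIntegral_mul_eq_integral_of_tsupport_subset hds,
    setIntegral_mul_eq_integral_of_tsupport_subset hφs,
    ← setIntegral_mul_eq_integral_of_tsupport_subset (hds.trans hsub),
    ← setIntegral_mul_eq_integral_of_tsupport_subset (hφs.trans hsub),
    h.integral_mul_deriv hφ hφc (hφs.trans hsub)]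

lemma memSobolev (h : HasL2WeakDeriv a b u v) : MemSobolev a b 1 u := by
  refine ⟨h.memLp, fun k hk => ?_⟩
  interval_cases k
  · exact ⟨u, h.memLp, h.hasWeakDeriv.1, h.hasWeakDeriv.1, by simp⟩
  · exact ⟨v, h.memLp_deriv, h.hasWeakDeriv⟩

lemma sq_h1Norm (h : HasL2WeakDeriv 0 1 u v) :
    h1Norm u ^ 2 = (∫ x, u x ^ 2 ∂unitVol) + ∫ x, v x ^ 2 ∂unitVol := by
  rw [h1Norm, Real.sq_sqrt (add_nonneg (integral_nonneg fun x => sq_nonneg _)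
    (integral_nonneg fun x => sq_nonneg _))]
  congr 1
  exact integral_congr_ae ((weakDeriv_ae_eq h.hasWeakDeriv).mono fun x hx => by simp only [hx])

end HasL2WeakDeriv

lemma sq_l2Norm (u : ℝ → ℝ) : l2Norm u ^ 2 = ∫ x, u x ^ 2 ∂unitVol :=
  Real.sq_sqrt (integral_nonneg fun _ => sq_nonneg _)

lemma hasL2WeakDeriv_of_contDiff (hab : a ≤ b) (hu : ContDiff ℝ 1 u) :
    HasL2WeakDeriv a b u (deriv u) := by
  have hu' : Continuous (deriv u) := hu.continuous_deriv le_rfl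
  refine hasL2WeakDeriv_iff.2 ⟨memLp_Ioo_of_continuous hu.continuous, memLp_Ioo_of_continuous hu',
    fun φ hφ _ hφs => ?_⟩
  have h0 : ∀ x, x ∉ Ioo a b → φ x = 0 := fun _ hx =>
    image_eq_zero_of_notMem_tsupport fun h' => hx (hφs h')
  simp only [← integral_Ioc_eq_integral_Ioo]
  rw [← intervalIntegral.integral_of_le hab, ← intervalIntegral.integral_of_le hab,
    intervalIntegral.integral_mul_deriv_eq_deriv_mul
      (fun x _ => (hu.differentiable one_ne_zero).differentiableAt.hasDerivAt)
      (fun x _ => (hφ.differentiable (by simp)).differentiableAt.hasDerivAt)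
      (hu'.intervalIntegrable _ _) ((hφ.continuous_deriv (by simp)).intervalIntegrable _ _),
    h0 a (by simp), h0 b (by simp)]
  ring

end WeakDerivative

section DilationAverage

variable {w g g' φ : ℝ → ℝ}

lemma HasL2WeakDeriv.integral_comp_mul (h : HasL2WeakDeriv 0 1 g g') (hφ : ContDiff ℝ ∞ φ)
    (hφc : HasCompactSupport φ) (hφs : tsupport φ ⊆ Ioo 0 1) {t : ℝ} (ht : t ∈ Ioo (0 : ℝ) 1) :
    ∫ s, g (t * s) * deriv φ s ∂unitVol = -(t * ∫ s, g' (t * s) * φ s ∂unitVol) := by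
  have ht0 : t ≠ 0 := ht.1.ne'
  set e := Homeomorph.mulLeft₀ t⁻¹ (inv_ne_zero ht0)
  have hψs : tsupport (φ ∘ e) ⊆ Ioo 0 1 := fun x hx => by
    rw [tsupport_comp_eq_preimage] at hx
    have hx' : t⁻¹ * x ∈ Ioo (0 : ℝ) 1 := hφs hx
    have hxe : x = t * (t⁻¹ * x) := by field_simp
    rw [hxe]
    exact ⟨mul_pos ht.1 hx'.1, mul_lt_one_of_nonneg_of_lt_one_left ht.1.le ht.2 hx'.2.le⟩
  have hψ : ContDiff ℝ ∞ (φ ∘ e) := hφ.comp (contDiff_const.mul contDiff_id)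
  have hdψ : ∀ x, deriv (φ ∘ e) x = t⁻¹ * deriv φ (t⁻¹ * x) := deriv_comp_mul_left t⁻¹ φ
  have hdil : ∀ u χ : ℝ → ℝ, ∫ s, u (t * s) * χ s = t⁻¹ * ∫ x, u x * χ (t⁻¹ * x) := fun u χ => by
    have := Measure.integral_comp_mul_left (fun x => u x * χ (t⁻¹ * x)) t
    simpa only [inv_mul_cancel_left₀ ht0, abs_of_pos (inv_pos.2 ht.1), smul_eq_mul] using this
  have key := h.integral_mul_deriv hψ (hφc.comp_homeomorph e) hψs
  rw [setIntegral_mul_eq_integral_of_tsupport_subset (tsupport_deriv_subset.trans hψs),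
    setIntegral_mul_eq_integral_of_tsupport_subset hψs] at key
  simp only [hdψ, mul_left_comm _ t⁻¹, integral_const_mul] at key
  rw [setIntegral_mul_eq_integral_of_tsupport_subset (tsupport_deriv_subset.trans hφs),
    setIntegral_mul_eq_integral_of_tsupport_subset hφs, hdil, hdil, key, mul_inv_cancel_left₀ ht0]
  rfl

lemma integrable_prod_comp_mul (hgm : Measurable g) (hg : MemLp g 2 unitVol) :
    Integrable (fun p : ℝ × ℝ => g (p.2 * p.1)) (unitVol.prod unitVol) := by
  have hmeas : Measurable fun p : ℝ × ℝ => g (p.2 * p.1) := by fun_prop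
  refine (integrable_prod_iff hmeas.aestronglyMeasurable).2 ⟨?_, ?_⟩
  · filter_upwards [ae_restrict_mem measurableSet_Ioo] with s hs
    exact (memLp_comp_mul hg hs).integrable one_le_two
  · have h := memLp_dilAvg (w := fun _ => 1) continuous_const hg.norm
    refine (h.integrable one_le_two).congr (ae_of_all _ fun s => ?_)
    simp [dilAvg_eq_setIntegral]

lemma integral_dilAvg_mul (hw : Continuous w) (hg : MemLp g 2 unitVol) (hφ : Continuous φ) :
    ∫ s, dilAvg w g s * φ s ∂unitVol = ∫ t, w t * ∫ s, g (t * s) * φ s ∂unitVol ∂unitVol := by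
  obtain ⟨M, hM⟩ := exists_abs_le_of_continuous hw
  obtain ⟨C, hC⟩ := exists_abs_le_of_continuous hφ
  set g₀ := hg.1.mk g
  have hgg₀ : g =ᵐ[unitVol] g₀ := hg.1.ae_eq_mk
  have h_int : Integrable (fun p : ℝ × ℝ => g₀ (p.2 * p.1) * w p.2 * φ p.1)
      (unitVol.prod unitVol) :=
    ((integrable_prod_comp_mul hg.1.stronglyMeasurable_mk.measurable (hg.ae_eq hgg₀)).mul_bdd
      (c := M) (by fun_prop) (Measure.quasiMeasurePreserving_snd.ae
        ((ae_restrict_mem measurableSet_Ioo).mono hM))).mul_bdd (c := C) (by fun_prop)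
      (Measure.quasiMeasurePreserving_fst.ae ((ae_restrict_mem measurableSet_Ioo).mono hC))
  calc ∫ s, dilAvg w g s * φ s ∂unitVol
      = ∫ s, ∫ t, g₀ (t * s) * w t * φ s ∂unitVol ∂unitVol := by
        refine setIntegral_congr_fun measurableSet_Ioo fun s hs => ?_
        simp only [dilAvg_congr hgg₀ hs, dilAvg_eq_setIntegral, integral_mul_const]
    _ = ∫ t, ∫ s, g₀ (t * s) * w t * φ s ∂unitVol ∂unitVol := integral_integral_swap h_int
    _ = ∫ t, w t * ∫ s, g (t * s) * φ s ∂unitVol ∂unitVol := by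
        refine setIntegral_congr_fun measurableSet_Ioo fun t ht => ?_
        rw [← integral_const_mul]
        refine integral_congr_ae ?_
        filter_upwards [ae_comp_mul hgg₀ ht] with s hs
        rw [mul_comm t s, hs]
        ring

lemma HasL2WeakDeriv.dilAvg (hw : Continuous w) (h : HasL2WeakDeriv 0 1 g g') :
    HasL2WeakDeriv 0 1 (dilAvg w g) (dilAvg (fun t => t * w t) g') := by
  have hw' : Continuous fun t => t * w t := by fun_prop
  refine hasL2WeakDeriv_iff.2 ⟨memLp_dilAvg hw h.memLp, memLp_dilAvg hw' h.memLp_deriv,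
    fun φ hφ hφc hφs => ?_⟩
  rw [integral_dilAvg_mul hw h.memLp (hφ.continuous_deriv (by simp)),
    integral_dilAvg_mul hw' h.memLp_deriv hφ.continuous, ← integral_neg]
  refine setIntegral_congr_fun measurableSet_Ioo fun t ht => ?_
  simp only [h.integral_comp_mul hφ hφc hφs ht]
  ring

end DilationAverage

section Injectivity

variable {w g : ℝ → ℝ}

lemma contDiff_iteratedDeriv (hg : ContDiff ℝ ∞ g) (m : ℕ) : ContDiff ℝ ∞ (iteratedDeriv m g) := by
  rw [iteratedDeriv_eq_iterate]
  exact hg.iterate_deriv m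

lemma hasL2WeakDeriv_iteratedDeriv {a b : ℝ} (hab : a ≤ b) (hg : ContDiff ℝ ∞ g) (m : ℕ) :
    HasL2WeakDeriv a b (iteratedDeriv m g) (iteratedDeriv (m + 1) g) := by
  rw [iteratedDeriv_succ]
  exact hasL2WeakDeriv_of_contDiff hab ((contDiff_iteratedDeriv hg m).of_le (by simp))

lemma continuous_dilAvg (hw : Continuous w) (hg : Continuous g) : Continuous (dilAvg w g) :=
  intervalIntegral.continuous_parametric_intervalIntegral_of_continuous'
    (by unfold Function.uncurry; fun_prop) 0 1

lemma dilAvg_iteratedDeriv_ae_eq_zero (hw : Continuous w) (hg : ContDiff ℝ ∞ g)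
    (h : dilAvg w g =ᵐ[unitVol] 0) (n : ℕ) :
    dilAvg (fun t => t ^ n * w t) (iteratedDeriv n g) =ᵐ[unitVol] 0 := by
  induction n with
  | zero => simpa using h
  | succ n ih =>
    have hD : HasL2WeakDeriv 0 1 0
        (dilAvg (fun t => t * (t ^ n * w t)) (iteratedDeriv (n + 1) g)) :=
      (HasL2WeakDeriv.dilAvg (by fun_prop) (hasL2WeakDeriv_iteratedDeriv zero_le_one hg n)).congr
        ih .rfl
    have h0 : HasL2WeakDeriv 0 1 0 0 := by
      simpa [← Pi.zero_def] using hD.sub hD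
    simpa only [pow_succ', mul_assoc] using hD.hasWeakDeriv.ae_eq h0.hasWeakDeriv

lemma iteratedDeriv_eq_zero_of_dilAvg_ae_eq_zero (hw : Continuous w)
    (hpos : ∀ t ∈ Ioo (0 : ℝ) 1, 0 < w t) (hg : ContDiff ℝ ∞ g) (h : dilAvg w g =ᵐ[unitVol] 0)
    (n : ℕ) : iteratedDeriv n g 0 = 0 := by
  have hwn : Continuous fun t => t ^ n * w t := by fun_prop
  have hcont := continuous_dilAvg hwn (contDiff_iteratedDeriv hg n).continuous
  have hIoo : EqOn (dilAvg (fun t => t ^ n * w t) (iteratedDeriv n g)) 0 (Ioo 0 1) :=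
    Measure.eqOn_open_of_ae_eq (dilAvg_iteratedDeriv_ae_eq_zero hw hg h n) isOpen_Ioo
      hcont.continuousOn continuousOn_const
  have h0 : iteratedDeriv n g 0 * ∫ t in (0 : ℝ)..1, t ^ n * w t = 0 := by
    have := hIoo.closure hcont continuous_const
    rw [closure_Ioo zero_ne_one] at this
    simpa [dilAvg] using this ⟨le_rfl, zero_le_one⟩
  refine (mul_eq_zero.1 h0).resolve_right (ne_of_gt ?_)
  exact intervalIntegral.intervalIntegral_pos_of_pos_on (hwn.intervalIntegrable _ _)
    (fun t ht => mul_pos (pow_pos ht.1 n) (hpos t ht)) zero_lt_one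

end Injectivity

section CosineSums

variable {K : ℕ}

lemma cosBasis_eq (k : ℕ) :
    cosBasis k = fun t => cosBasis k 0 * Real.cos (Real.pi * k * t) := by
  ext t
  rcases eq_or_ne k 0 with rfl | hk <;> simp [cosBasis, *]

lemma cosBasis_zero_ne_zero (k : ℕ) : cosBasis k 0 ≠ 0 := by
  unfold cosBasis
  split_ifs <;> simp

lemma contDiff_cosBasis (k : ℕ) : ContDiff ℝ ∞ (cosBasis k) := by
  rw [cosBasis_eq]
  fun_prop

lemma contDiff_cosSum (a : Fin K → ℝ) : ContDiff ℝ ∞ (cosSum a) :=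
  ContDiff.sum fun k _ => contDiff_const.mul (contDiff_cosBasis k)

lemma continuous_iteratedDeriv_cosBasis (m k : ℕ) : Continuous (iteratedDeriv m (cosBasis k)) :=
  (contDiff_iteratedDeriv (contDiff_cosBasis k) m).continuous

lemma iteratedDeriv_cosSum (m : ℕ) (a : Fin K → ℝ) :
    iteratedDeriv m (cosSum a) = fun t => ∑ k, a k * iteratedDeriv m (cosBasis k) t := by
  ext t
  have hsmooth : ∀ k ∈ Finset.univ, ContDiffAt ℝ m (fun x => a k * cosBasis k x) t := fun k _ =>
    (contDiff_const.mul ((contDiff_cosBasis k).of_le (mod_cast le_top))).contDiffAt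
  exact (iteratedDeriv_fun_sum hsmooth).trans (by simp only [iteratedDeriv_const_mul_field])

lemma iteratedDeriv_cosBasis (m k : ℕ) (t : ℝ) : iteratedDeriv m (cosBasis k) t =
    cosBasis k 0 * (Real.pi * k) ^ m * iteratedDeriv m Real.cos (Real.pi * k * t) := by
  conv_lhs => rw [cosBasis_eq, iteratedDeriv_const_mul_field]
  rw [congrFun (iteratedDeriv_comp_const_mul Real.contDiff_cos _) t,
    mul_assoc (cosBasis k 0)]

lemma eq_zero_of_dilAvg_cosSum_ae_eq_zero {w : ℝ → ℝ} (hw : Continuous w)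
    (hpos : ∀ t ∈ Ioo (0 : ℝ) 1, 0 < w t) {a : Fin K → ℝ}
    (h : dilAvg w (cosSum a) =ᵐ[unitVol] 0) : a = 0 := by
  have hinj : Function.Injective fun k : Fin K => -(Real.pi * k) ^ 2 := fun i j hij => by
    have hij' : (Real.pi * i) ^ 2 = (Real.pi * j) ^ 2 := neg_injective hij
    rw [sq_eq_sq₀ (by positivity) (by positivity)] at hij'
    exact Fin.ext (by exact_mod_cast mul_left_cancel₀ Real.pi_ne_zero hij')
  have hvandermonde : (fun k : Fin K => a k * cosBasis k 0) = 0 := by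
    refine Matrix.eq_zero_of_forall_pow_sum_mul_pow_eq_zero hinj fun i => ?_
    have h2i := iteratedDeriv_eq_zero_of_dilAvg_ae_eq_zero hw hpos (contDiff_cosSum a) h (2 * i)
    rw [iteratedDeriv_cosSum] at h2i
    refine Eq.trans (Finset.sum_congr rfl fun k _ => ?_) h2i
    rw [iteratedDeriv_cosBasis, Real.iteratedDeriv_even_cos]
    simp [pow_mul, neg_pow (_ ^ 2 : ℝ)]
    ring
  ext k
  exact (mul_eq_zero.1 (congrFun hvandermonde k)).resolve_right (cosBasis_zero_ne_zero k)

end CosineSums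

section LeastSquares

variable {K : ℕ}

lemma existsUnique_leastSquares {E : Type*} [NormedAddCommGroup E] [InnerProductSpace ℝ E]
    {p : Fin K → E} (hp : LinearIndependent ℝ p) (x : E) :
    ∃! a : Fin K → ℝ, ∀ b : Fin K → ℝ,
      ‖∑ k, a k • p k - x‖ ^ 2 ≤ ‖∑ k, b k • p k - x‖ ^ 2 := by
  set U := Submodule.span ℝ (Set.range p)
  have : FiniteDimensional ℝ U := FiniteDimensional.span_of_finite ℝ (finite_range p)
  set y := U.starProjection x
  obtain ⟨a, ha⟩ := (Submodule.mem_span_range_iff_exists_fun ℝ).1 (U.starProjection_apply_mem x)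
  have hpyth : ∀ b : Fin K → ℝ, ‖∑ k, b k • p k - x‖ ^ 2 =
      ‖∑ k, b k • p k - y‖ ^ 2 + ‖y - x‖ ^ 2 := fun b => by
    have hb : ∑ k, b k • p k - y ∈ U := U.sub_mem
      ((Submodule.mem_span_range_iff_exists_fun ℝ).2 ⟨b, rfl⟩) (U.starProjection_apply_mem x)
    have horth : inner ℝ (∑ k, b k • p k - y) (y - x) = 0 := by
      rw [real_inner_comm, ← neg_sub x y, inner_neg_left, U.starProjection_inner_eq_zero x _ hb,
        neg_zero]
    rw [← sub_add_sub_cancel _ y x, norm_add_sq_real, horth]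
    ring
  refine ⟨a, fun b => ?_, fun a' ha' => ?_⟩
  · rw [hpyth a, hpyth b, ha, sub_self, norm_zero]
    nlinarith [sq_nonneg ‖∑ k, b k • p k - y‖]
  · have hle := ha' a
    rw [hpyth a, hpyth a', ha, sub_self, norm_zero] at hle
    have hy : ∑ k, a' k • p k = y :=
      sub_eq_zero.1 (norm_eq_zero.1 (pow_eq_zero_iff two_ne_zero |>.1
        (le_antisymm (by linarith) (sq_nonneg _))))
    exact Fintype.linearIndependent_iffₛ.1 hp a' a (hy.trans ha.symm) |> funext

lemma sq_norm_sum_toLp_sub {α : Type*} [MeasurableSpace α] {μ : Measure α}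
    {φ : Fin K → α → ℝ} (hφ : ∀ k, MemLp (φ k) 2 μ) {Y : α → ℝ} (hY : MemLp Y 2 μ)
    (b : Fin K → ℝ) :
    ‖∑ k, b k • (hφ k).toLp - hY.toLp‖ ^ 2 = ∫ s, (∑ k, b k * φ k s - Y s) ^ 2 ∂μ := by
  rw [← real_inner_self_eq_norm_sq, L2.inner_def]
  refine integral_congr_ae ?_
  filter_upwards [Lp.coeFn_sub (∑ k, b k • (hφ k).toLp) hY.toLp, hY.coeFn_toLp,
    Lp.coeFn_finsetSum Finset.univ (fun k => b k • (hφ k).toLp),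
    ae_all_iff.2 fun k => (hφ k).coeFn_toLp,
    ae_all_iff.2 fun k => Lp.coeFn_smul (b k) (hφ k).toLp] with s hsub hYs hsum hφs hsmul
  rw [hsub, Pi.sub_apply, hsum, hYs, real_inner_self_eq_norm_sq, Real.norm_eq_abs, sq_abs]
  simp [hsmul, hφs]

end LeastSquares

section Minimizers

variable {d K : ℕ}

/-- The weight `t^m ϱ_d(t)`. Each differentiation of `S_d[f]` raises `m` by one. -/
def momentDensity (d m : ℕ) (t : ℝ) : ℝ := t ^ m * density d t

lemma slicing_eq_dilAvg (d : ℕ) : slicing d = dilAvg (momentDensity d 0) := by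
  ext f s
  simp [slicing, dilAvg, momentDensity]

lemma normConst_pos (hd : 2 ≤ d) : 0 < normConst d := by
  have h : (2 : ℝ) ≤ d := by exact_mod_cast hd
  have : 0 < Real.Gamma ((d : ℝ) / 2) := Real.Gamma_pos_of_pos (by linarith)
  have : 0 < Real.Gamma (((d : ℝ) - 1) / 2) := Real.Gamma_pos_of_pos (by linarith)
  unfold normConst
  positivity

lemma continuous_momentDensity (hd : 3 ≤ d) (m : ℕ) : Continuous (momentDensity d m) := by
  have h : (0 : ℝ) ≤ ((d : ℝ) - 3) / 2 := by
    have : (3 : ℝ) ≤ d := by exact_mod_cast hd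
    linarith
  have := Real.continuous_rpow_const h
  unfold momentDensity density
  fun_prop

lemma momentDensity_pos (hd : 2 ≤ d) (m : ℕ) {t : ℝ} (ht : t ∈ Ioo (0 : ℝ) 1) :
    0 < momentDensity d m t :=
  mul_pos (pow_pos ht.1 m)
    (mul_pos (normConst_pos hd) (Real.rpow_pos_of_pos (by nlinarith [ht.1, ht.2]) _))

lemma abs_momentDensity_le (hd : 3 ≤ d) (m : ℕ) {ε t : ℝ} (hε : ε ≤ 1) (ht : t ∈ Ioo (1 - ε) 1) :
    |momentDensity d m t| ≤ normConst d * (2 * ε) ^ (((d : ℝ) - 3) / 2) := by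
  have hd' : (3 : ℝ) ≤ d := by exact_mod_cast hd
  have ht0 : 0 < t := by linarith [ht.1]
  have hc := normConst_pos (show 2 ≤ d by omega)
  have h1 : 0 ≤ 1 - t ^ 2 := by nlinarith [ht.2]
  have h2 : 1 - t ^ 2 ≤ 2 * ε := by nlinarith [ht.1, ht.2]
  rw [abs_of_pos (momentDensity_pos (by omega) m ⟨ht0, ht.2⟩)]
  calc t ^ m * density d t ≤ 1 * density d t := by
        have : 0 ≤ density d t := by unfold density; positivity
        gcongr
        exact pow_le_one₀ ht0.le ht.2.le
    _ = normConst d * (1 - t ^ 2) ^ (((d : ℝ) - 3) / 2) := one_mul _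
    _ ≤ normConst d * (2 * ε) ^ (((d : ℝ) - 3) / 2) := by
        gcongr

lemma HasL2WeakDeriv.slicing (hd : 3 ≤ d) {g g' : ℝ → ℝ} (h : HasL2WeakDeriv 0 1 g g') :
    HasL2WeakDeriv 0 1 (slicing d g) (Slicing.dilAvg (momentDensity d 1) g') := by
  have hmoment : (fun t => t * momentDensity d 0 t) = momentDensity d 1 := by
    ext t
    simp [momentDensity]
  rw [slicing_eq_dilAvg, ← hmoment]
  exact h.dilAvg (continuous_momentDensity hd 0)

lemma hasL2WeakDeriv_slicing_cosSum (hd : 3 ≤ d) (a : Fin K → ℝ) :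
    HasL2WeakDeriv 0 1 (slicing d (cosSum a))
      (dilAvg (momentDensity d 1) (iteratedDeriv 1 (cosSum a))) :=
  (hasL2WeakDeriv_iteratedDeriv zero_le_one (contDiff_cosSum a) 0).slicing hd

lemma memLp_dilAvg_iteratedDeriv_cosBasis (hd : 3 ≤ d) (m k : ℕ) :
    MemLp (dilAvg (momentDensity d m) (iteratedDeriv m (cosBasis k))) 2 unitVol :=
  memLp_dilAvg (continuous_momentDensity hd m)
    (memLp_Ioo_of_continuous (continuous_iteratedDeriv_cosBasis m k))

lemma dilAvg_iteratedDeriv_cosSum (hd : 3 ≤ d) (m : ℕ) (a : Fin K → ℝ) (s : ℝ) :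
    dilAvg (momentDensity d m) (iteratedDeriv m (cosSum a)) s =
      ∑ k, a k * dilAvg (momentDensity d m) (iteratedDeriv m (cosBasis k)) s := by
  rw [iteratedDeriv_cosSum]
  exact dilAvg_sum _ (continuous_momentDensity hd m) a
    (fun k _ => continuous_iteratedDeriv_cosBasis m k) s

lemma slicing_cosSum (hd : 3 ≤ d) (a : Fin K → ℝ) (s : ℝ) : slicing d (cosSum a) s =
    ∑ k, a k * dilAvg (momentDensity d 0) (iteratedDeriv 0 (cosBasis k)) s := by
  rw [slicing_eq_dilAvg, ← dilAvg_iteratedDeriv_cosSum hd, iteratedDeriv_zero]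

lemma linearIndependent_toLp_dilAvg_cosBasis (hd : 3 ≤ d) : LinearIndependent ℝ fun k : Fin K =>
    (memLp_dilAvg_iteratedDeriv_cosBasis hd 0 k).toLp := by
  refine Fintype.linearIndependent_iff.2 fun a ha => congrFun ?_
  have h_int : Integrable (fun s => slicing d (cosSum a) s ^ 2) unitVol :=
    (hasL2WeakDeriv_slicing_cosSum hd a).memLp.integrable_sq
  have hzero : ∫ s, slicing d (cosSum a) s ^ 2 ∂unitVol = 0 := by
    have h := sq_norm_sum_toLp_sub (fun k : Fin K => memLp_dilAvg_iteratedDeriv_cosBasis hd 0 k)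
      (MemLp.zero (ε := ℝ)) a
    rw [ha, MemLp.toLp_zero, sub_zero, norm_zero] at h
    simpa [slicing_cosSum hd] using h.symm
  refine eq_zero_of_dilAvg_cosSum_ae_eq_zero (continuous_momentDensity hd 0)
    (fun t => momentDensity_pos (by omega) 0) ?_
  filter_upwards [(integral_eq_zero_iff_of_nonneg (fun s => sq_nonneg _) h_int).1 hzero] with s hs
  rw [← slicing_eq_dilAvg]
  exact pow_eq_zero_iff two_ne_zero |>.1 hs

theorem existsUnique_isMinimizer_l2Norm (hd : 3 ≤ d) {F : ℝ → ℝ} (hF : MemLp F 2 unitVol) (K : ℕ) :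
    ∃! a : Fin K → ℝ, IsMinimizer l2Norm d F a := by
  simpa only [IsMinimizer, sq_l2Norm, slicing_cosSum hd, sq_norm_sum_toLp_sub] using
    existsUnique_leastSquares (linearIndependent_toLp_dilAvg_cosBasis hd) hF.toLp

theorem existsUnique_isMinimizer_h1Norm (hd : 3 ≤ d) {F F' : ℝ → ℝ} (hF : HasL2WeakDeriv 0 1 F F')
    (K : ℕ) : ∃! a : Fin K → ℝ, IsMinimizer h1Norm d F a := by
  set L := Lp ℝ 2 unitVol
  have hp := fun m (k : Fin K) => memLp_dilAvg_iteratedDeriv_cosBasis hd m k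
  set P : Fin K → WithLp 2 (L × L) := fun k => WithLp.toLp 2 ((hp 0 k).toLp, (hp 1 k).toLp)
  set Y : WithLp 2 (L × L) := WithLp.toLp 2 (hF.memLp.toLp, hF.memLp_deriv.toLp)
  have hP : LinearIndependent ℝ P := LinearIndependent.of_comp (WithLp.fstₗ 2 ℝ L L)
    (linearIndependent_toLp_dilAvg_cosBasis hd)
  have hnorm : ∀ b : Fin K → ℝ, ‖∑ k, b k • P k - Y‖ ^ 2 =
      h1Norm (fun s => slicing d (cosSum b) s - F s) ^ 2 := fun b => by
    have hfst : (∑ k, b k • P k - Y).fst = ∑ k, b k • (hp 0 k).toLp - hF.memLp.toLp :=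
      congrArg (· - hF.memLp.toLp) (map_sum (WithLp.fstₗ 2 ℝ L L) _ _)
    have hsnd : (∑ k, b k • P k - Y).snd = ∑ k, b k • (hp 1 k).toLp - hF.memLp_deriv.toLp :=
      congrArg (· - hF.memLp_deriv.toLp) (map_sum (WithLp.sndₗ 2 ℝ L L) _ _)
    rw [((hasL2WeakDeriv_slicing_cosSum hd b).sub hF).sq_h1Norm, WithLp.prod_norm_sq_eq_of_L2,
      hfst, hsnd, sq_norm_sum_toLp_sub, sq_norm_sum_toLp_sub]
    simp only [slicing_cosSum hd, dilAvg_iteratedDeriv_cosSum hd]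
  simpa only [IsMinimizer, hnorm] using existsUnique_leastSquares hP Y

end Minimizers

section Fourier

variable {g g' u v W : ℝ → ℝ} {K : ℕ}

/-- Lebesgue measure on `(-1, 1)`, a period of the circle `ℝ / 2ℤ`. -/
abbrev symVol : Measure ℝ := volume.restrict (Ioo (-1 : ℝ) 1)

/-- The cosine coefficient `∫ g(x) cos(π n x) dx` of `g` over `(-1, 1)`, without normalisation. -/
def cosCoeff (g : ℝ → ℝ) (n : ℤ) : ℝ := ∫ x, g x * Real.cos (Real.pi * n * x) ∂symVol

/-- The sine coefficient `∫ g(x) sin(π n x) dx` of `g` over `(-1, 1)`, without normalisation. -/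
def sinCoeff (g : ℝ → ℝ) (n : ℤ) : ℝ := ∫ x, g x * Real.sin (Real.pi * n * x) ∂symVol

/-- The energy of `g` at the frequency `n`, that is four times the squared modulus of its `n`-th
complex Fourier coefficient on `(-1, 1)`. -/
def energy (g : ℝ → ℝ) (n : ℤ) : ℝ := cosCoeff g n ^ 2 + sinCoeff g n ^ 2

lemma energy_nonneg (g : ℝ → ℝ) (n : ℤ) : 0 ≤ energy g n :=
  add_nonneg (sq_nonneg _) (sq_nonneg _)

lemma integrable_mul_of_continuous {a b : ℝ} {ψ : ℝ → ℝ}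
    (hg : MemLp g 2 (volume.restrict (Ioo a b))) (hψ : Continuous ψ) :
    Integrable (fun x => g x * ψ x) (volume.restrict (Ioo a b)) :=
  MemLp.integrable_mul (p := 2) (q := 2) hg (memLp_Ioo_of_continuous hψ)

lemma cosCoeff_sub (hg : MemLp g 2 symVol) (hg' : MemLp g' 2 symVol) (n : ℤ) :
    cosCoeff (fun x => g x - g' x) n = cosCoeff g n - cosCoeff g' n := by
  simp only [cosCoeff, sub_mul]
  exact integral_sub (integrable_mul_of_continuous hg (by fun_prop))
    (integrable_mul_of_continuous hg' (by fun_prop))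

lemma sinCoeff_sub (hg : MemLp g 2 symVol) (hg' : MemLp g' 2 symVol) (n : ℤ) :
    sinCoeff (fun x => g x - g' x) n = sinCoeff g n - sinCoeff g' n := by
  simp only [sinCoeff, sub_mul]
  exact integral_sub (integrable_mul_of_continuous hg (by fun_prop))
    (integrable_mul_of_continuous hg' (by fun_prop))

lemma cosCoeff_natAbs (g : ℝ → ℝ) (n : ℤ) : cosCoeff g n.natAbs = cosCoeff g n := by
  rcases Int.natAbs_eq n with h | h
  · rw [← h]
  · nth_rewrite 2 [h]
    simp [cosCoeff]

lemma sinCoeff_eq_zero_of_even (hu : ∀ x, u (-x) = u x) (n : ℤ) : sinCoeff u n = 0 := by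
  have h11 : (-1 : ℝ) ≤ 1 := by norm_num
  have hneg := intervalIntegral.integral_comp_neg (a := -1) (b := 1)
    fun x => u x * Real.sin (Real.pi * n * x)
  simp only [hu, mul_neg, Real.sin_neg, intervalIntegral.integral_neg, neg_neg] at hneg
  rw [sinCoeff, ← integral_Ioc_eq_integral_Ioo, ← intervalIntegral.integral_of_le h11]
  linarith

lemma fourierCoeffOn_eq (h11 : (-1 : ℝ) < 1) (hg : MemLp g 2 symVol) (n : ℤ) :
    fourierCoeffOn h11 (fun x => (g x : ℂ)) n =
      (1 / 2 : ℝ) • ((cosCoeff g n : ℂ) - (sinCoeff g n : ℂ) * Complex.I) := by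
  have hcos : Integrable (fun x => g x * Real.cos (Real.pi * n * x)) symVol :=
    integrable_mul_of_continuous hg (by fun_prop)
  have hsin : Integrable (fun x => g x * Real.sin (Real.pi * n * x)) symVol :=
    integrable_mul_of_continuous hg (by fun_prop)
  rw [fourierCoeffOn_eq_integral, intervalIntegral.integral_of_le h11.le,
    integral_Ioc_eq_integral_Ioo, cosCoeff, sinCoeff, ← integral_complex_ofReal,
    ← integral_complex_ofReal, ← integral_mul_const,
    ← integral_sub hcos.ofReal (hsin.ofReal.mul_const _)]
  congr 1
  · norm_num
  refine integral_congr_ae (ae_of_all _ fun x => ?_)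
  have hexp : 2 * (Real.pi : ℂ) * Complex.I * ((-n : ℤ) : ℂ) * (x : ℂ) / ((1 - -1 : ℝ) : ℂ) =
      ((-(Real.pi * n * x) : ℝ) : ℂ) * Complex.I := by
    push_cast
    ring
  simp only [fourier_coe_apply, smul_eq_mul]
  rw [hexp, Complex.exp_mul_I, ← Complex.ofReal_cos, ← Complex.ofReal_sin, Real.cos_neg,
    Real.sin_neg]
  push_cast
  ring

lemma hasSum_energy (hg : MemLp g 2 symVol) : HasSum (energy g) (2 * ∫ x, g x ^ 2 ∂symVol) := by
  have h11 : (-1 : ℝ) < 1 := by norm_num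
  have hgℂ : MemLp (fun x => (g x : ℂ)) 2 (volume.restrict (Ioc (-1 : ℝ) 1)) := by
    rw [restrict_Ioo_eq_restrict_Ioc.symm]
    exact hg.ofReal
  have hcoeff : ∀ n, 4 * ‖fourierCoeffOn h11 (fun x => (g x : ℂ)) n‖ ^ 2 = energy g n := fun n => by
    rw [fourierCoeffOn_eq h11 hg, norm_smul, mul_pow, Complex.sq_norm, Complex.normSq_apply]
    simp [energy]
    ring
  have hparseval := (hasSum_sq_fourierCoeffOn h11 hgℂ).mul_left 4
  simp only [hcoeff, intervalIntegral.integral_of_le h11.le, integral_Ioc_eq_integral_Ioo,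
    Complex.norm_real, Real.norm_eq_abs, sq_abs, smul_eq_mul] at hparseval
  rwa [show ∀ I : ℝ, 4 * ((1 - -1)⁻¹ * I) = 2 * I from fun I => by ring] at hparseval

lemma mul_integral_sq_le_of_energy_le (hg : MemLp g 2 symVol) (hW : MemLp W 2 symVol) {c : ℝ}
    (h : ∀ n, c * energy g n ≤ energy W n) :
    c * ∫ x, g x ^ 2 ∂symVol ≤ ∫ x, W x ^ 2 ∂symVol := by
  linarith [hasSum_le h ((hasSum_energy hg).mul_left c) (hasSum_energy hW)]

end Fourier

section PeriodicWeakDeriv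

variable {u v u' v' : ℝ → ℝ}

/-- `u` and `v` are square integrable on the circle `ℝ / 2ℤ`, represented by `(-1, 1)`, and `v` is
the weak derivative of `u` there: test functions need only agree at `-1` and `1`. -/
structure HasPeriodicWeakDeriv (u v : ℝ → ℝ) : Prop where
  memLp : MemLp u 2 symVol
  memLp_deriv : MemLp v 2 symVol
  integral_mul_deriv : ∀ φ : ℝ → ℝ, ContDiff ℝ ∞ φ → φ (-1) = φ 1 →
    ∫ x, u x * deriv φ x ∂symVol = -∫ x, v x * φ x ∂symVol

lemma hasPeriodicWeakDeriv_of_contDiff (hu : ContDiff ℝ 1 u) (h1 : u (-1) = u 1) :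
    HasPeriodicWeakDeriv u (deriv u) where
  memLp := memLp_Ioo_of_continuous hu.continuous
  memLp_deriv := memLp_Ioo_of_continuous (hu.continuous_deriv le_rfl)
  integral_mul_deriv φ hφ hφ1 := by
    have h11 : (-1 : ℝ) ≤ 1 := by norm_num
    simp only [← integral_Ioc_eq_integral_Ioo, ← intervalIntegral.integral_of_le h11]
    rw [intervalIntegral.integral_mul_deriv_eq_deriv_mul
        (fun x _ => (hu.differentiable one_ne_zero).differentiableAt.hasDerivAt)
        (fun x _ => (hφ.differentiable (by simp)).differentiableAt.hasDerivAt)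
        ((hu.continuous_deriv le_rfl).intervalIntegrable _ _)
        ((hφ.continuous_deriv (by simp)).intervalIntegrable _ _), hφ1, h1]
    ring

namespace HasPeriodicWeakDeriv

lemma sub (h : HasPeriodicWeakDeriv u v) (h' : HasPeriodicWeakDeriv u' v') :
    HasPeriodicWeakDeriv (fun x => u x - u' x) (fun x => v x - v' x) where
  memLp := h.memLp.sub h'.memLp
  memLp_deriv := h.memLp_deriv.sub h'.memLp_deriv
  integral_mul_deriv φ hφ hφ1 := by
    have hφ' := hφ.continuous_deriv (by simp)
    simp only [sub_mul]
    rw [integral_sub (integrable_mul_of_continuous h.memLp hφ')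
        (integrable_mul_of_continuous h'.memLp hφ'),
      integral_sub (integrable_mul_of_continuous h.memLp_deriv hφ.continuous)
        (integrable_mul_of_continuous h'.memLp_deriv hφ.continuous),
      h.integral_mul_deriv φ hφ hφ1, h'.integral_mul_deriv φ hφ hφ1]
    ring

lemma const_mul (h : HasPeriodicWeakDeriv u v) (c : ℝ) :
    HasPeriodicWeakDeriv (fun x => c * u x) (fun x => c * v x) where
  memLp := h.memLp.const_mul c
  memLp_deriv := h.memLp_deriv.const_mul c
  integral_mul_deriv φ hφ hφ1 := by
    simp only [mul_assoc, integral_const_mul, h.integral_mul_deriv φ hφ hφ1, mul_neg]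

lemma sum {ι : Type*} {s : Finset ι} {u v : ι → ℝ → ℝ}
    (h : ∀ i ∈ s, HasPeriodicWeakDeriv (u i) (v i)) :
    HasPeriodicWeakDeriv (fun x => ∑ i ∈ s, u i x) (fun x => ∑ i ∈ s, v i x) where
  memLp := memLp_finsetSum s fun i hi => (h i hi).memLp
  memLp_deriv := memLp_finsetSum s fun i hi => (h i hi).memLp_deriv
  integral_mul_deriv φ hφ hφ1 := by
    simp only [Finset.sum_mul]
    rw [integral_finsetSum s fun i hi => integrable_mul_of_continuous (h i hi).memLp
        (hφ.continuous_deriv (by simp)),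
      integral_finsetSum s fun i hi => integrable_mul_of_continuous (h i hi).memLp_deriv
        hφ.continuous, ← Finset.sum_neg_distrib]
    exact Finset.sum_congr rfl fun i hi => (h i hi).integral_mul_deriv φ hφ hφ1

lemma cosCoeff_eq (h : HasPeriodicWeakDeriv u v) (n : ℤ) :
    cosCoeff v n = Real.pi * n * sinCoeff u n := by
  have hderiv : deriv (fun x => Real.cos (Real.pi * n * x)) =
      fun x => -(Real.pi * n * Real.sin (Real.pi * n * x)) := by
    ext x
    rw [deriv_comp_mul_left (Real.pi * n) Real.cos, Real.deriv_cos, smul_eq_mul, mul_neg]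
  have htest := h.integral_mul_deriv (fun x => Real.cos (Real.pi * n * x)) (by fun_prop) (by simp)
  simp only [hderiv, mul_neg, integral_neg, neg_inj, mul_left_comm (u _), integral_const_mul]
    at htest
  exact htest.symm

lemma sinCoeff_eq (h : HasPeriodicWeakDeriv u v) (n : ℤ) :
    sinCoeff v n = -(Real.pi * n * cosCoeff u n) := by
  have hderiv : deriv (fun x => Real.sin (Real.pi * n * x)) =
      fun x => Real.pi * n * Real.cos (Real.pi * n * x) := by
    ext x
    rw [deriv_comp_mul_left (Real.pi * n) Real.sin, Real.deriv_sin, smul_eq_mul]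
  have hsin : Real.sin (Real.pi * n) = 0 := by rw [mul_comm, Real.sin_int_mul_pi]
  have htest := h.integral_mul_deriv (fun x => Real.sin (Real.pi * n * x)) (by fun_prop)
    (by simp [hsin])
  simp only [hderiv, mul_left_comm (u _), integral_const_mul] at htest
  rw [sinCoeff, cosCoeff, htest, neg_neg]

lemma energy_eq (h : HasPeriodicWeakDeriv u v) (n : ℤ) :
    energy v n = (Real.pi * n) ^ 2 * energy u n := by
  rw [energy, h.cosCoeff_eq, h.sinCoeff_eq, energy]
  ring

end HasPeriodicWeakDeriv

lemma energy_eq_of_chain {W : ℕ → ℝ → ℝ} {m : ℕ}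
    (h : ∀ j < m, HasPeriodicWeakDeriv (W j) (W (j + 1))) (n : ℤ) :
    energy (W m) n = ((Real.pi * n) ^ 2) ^ m * energy (W 0) n := by
  induction m with
  | zero => simp
  | succ m ih =>
    rw [(h m m.lt_succ_self).energy_eq, ih fun j hj => h j (hj.trans m.lt_succ_self)]
    ring

end PeriodicWeakDeriv

section CosineApproximation

variable {K : ℕ} {u : ℝ → ℝ}

lemma integral_cos_pi_mul (m : ℤ) :
    ∫ x, Real.cos (Real.pi * m * x) ∂symVol = if m = 0 then 2 else 0 := by
  have h11 : (-1 : ℝ) ≤ 1 := by norm_num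
  rw [← integral_Ioc_eq_integral_Ioo, ← intervalIntegral.integral_of_le h11]
  split_ifs with hm
  · norm_num [hm]
  · have hsin : Real.sin (Real.pi * m) = 0 := by rw [mul_comm, Real.sin_int_mul_pi]
    rw [intervalIntegral.integral_comp_mul_left (fun x => Real.cos x)
      (mul_ne_zero Real.pi_ne_zero (by exact_mod_cast hm)), integral_cos]
    simp [hsin]

lemma cosCoeff_cosBasis (k : ℕ) (n : ℤ) :
    cosCoeff (cosBasis k) n = if n.natAbs = k then 2 / cosBasis k 0 else 0 := by
  have hproduct : ∀ x, cosBasis k x * Real.cos (Real.pi * n * x) = cosBasis k 0 / 2 *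
      (Real.cos (Real.pi * (k + n : ℤ) * x) + Real.cos (Real.pi * (k - n : ℤ) * x)) := fun x => by
    rw [congrFun (cosBasis_eq k) x, show Real.pi * (k + n : ℤ) * x =
        Real.pi * k * x + Real.pi * n * x by push_cast; ring,
      show Real.pi * (k - n : ℤ) * x = Real.pi * k * x - Real.pi * n * x by push_cast; ring,
      Real.cos_add, Real.cos_sub]
    ring
  have h_int : ∀ m : ℤ, Integrable (fun x => Real.cos (Real.pi * m * x)) symVol := fun m =>
    (memLp_Ioo_of_continuous (by fun_prop)).integrable le_rfl
  simp only [cosCoeff, hproduct]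
  rw [integral_const_mul, integral_add (h_int _) (h_int _), integral_cos_pi_mul,
    integral_cos_pi_mul]
  rcases eq_or_ne k 0 with rfl | hk
  · simp only [cosBasis, if_true, Nat.cast_zero, zero_add, zero_sub, neg_eq_zero,
      Int.natAbs_eq_zero]
    split_ifs <;> norm_num
  · have hsq : cosBasis k 0 * cosBasis k 0 = 2 := by simp [cosBasis, hk]
    have hval : cosBasis k 0 / 2 * 2 = 2 / cosBasis k 0 := by
      rw [eq_div_iff (cosBasis_zero_ne_zero k)]
      linarith
    split_ifs <;> first | omega | simp [hval]

lemma cosCoeff_cosSum (b : Fin K → ℝ) (n : ℤ) : cosCoeff (cosSum b) n =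
    if h : n.natAbs < K then b ⟨n.natAbs, h⟩ * (2 / cosBasis n.natAbs 0) else 0 := by
  have hsum : cosCoeff (cosSum b) n = ∑ k : Fin K, b k * cosCoeff (cosBasis k) n := by
    simp only [cosCoeff, cosSum, Finset.sum_mul, mul_assoc]
    rw [integral_finsetSum _ fun k _ => ?_]
    · simp only [integral_const_mul]
    · exact (integrable_mul_of_continuous (memLp_Ioo_of_continuous (contDiff_cosBasis k).continuous)
        (by fun_prop)).const_mul (b k)
  rw [hsum]
  simp only [cosCoeff_cosBasis]
  split_ifs with h
  · rw [Finset.sum_eq_single ⟨n.natAbs, h⟩ (fun k _ hk => ?_) (by simp)]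
    · simp
    · rw [if_neg fun h' => hk (Fin.ext h'.symm), mul_zero]
  · exact Finset.sum_eq_zero fun k _ => by rw [if_neg (by omega), mul_zero]

lemma cosSum_neg (b : Fin K → ℝ) (x : ℝ) : cosSum b (-x) = cosSum b x := by
  simp [cosSum, cosBasis]

lemma cosSum_add_two (b : Fin K → ℝ) (x : ℝ) : cosSum b (x + 2) = cosSum b x := by
  have hperiod : ∀ k : ℕ, Real.cos (Real.pi * k * (x + 2)) = Real.cos (Real.pi * k * x) :=
    fun k => by
      rw [← Real.cos_add_nat_mul_two_pi (Real.pi * k * x) k]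
      congr 1
      ring
  simp only [cosSum, cosBasis, hperiod]

lemma hasPeriodicWeakDeriv_iteratedDeriv_cosSum (b : Fin K → ℝ) (m : ℕ) :
    HasPeriodicWeakDeriv (iteratedDeriv m (cosSum b)) (iteratedDeriv (m + 1) (cosSum b)) := by
  have hperiod : iteratedDeriv m (cosSum b) (-1) = iteratedDeriv m (cosSum b) 1 := by
    have h := congrFun (iteratedDeriv_comp_add_const m (cosSum b) 2) (-1)
    rw [funext (cosSum_add_two b)] at h
    exact h.trans (by norm_num)
  rw [iteratedDeriv_succ]
  exact hasPeriodicWeakDeriv_of_contDiff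
    ((contDiff_iteratedDeriv (contDiff_cosSum b) m).of_le (by simp)) hperiod

lemma exists_energy_sub_cosSum_eq (hu : MemLp u 2 symVol) (heven : ∀ x, u (-x) = u x) (K : ℕ) :
    ∃ b : Fin K → ℝ, ∀ n : ℤ, energy (fun x => u x - cosSum b x) n =
      if n.natAbs < K then 0 else energy u n := by
  refine ⟨fun k => cosCoeff u (k : ℕ) / (2 / cosBasis k 0), fun n => ?_⟩
  have hcosSum : ∀ b : Fin K → ℝ, MemLp (cosSum b) 2 symVol := fun b =>
    memLp_Ioo_of_continuous (contDiff_cosSum b).continuous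
  rw [energy, energy, cosCoeff_sub hu (hcosSum _), sinCoeff_sub hu (hcosSum _), cosCoeff_cosSum,
    sinCoeff_eq_zero_of_even heven, sinCoeff_eq_zero_of_even (cosSum_neg _)]
  split_ifs with hn
  · rw [div_mul_cancel₀ _ (div_ne_zero two_ne_zero (cosBasis_zero_ne_zero _)), cosCoeff_natAbs]
    ring
  · ring

theorem exists_cosSum_approx {r : ℕ} {W : ℕ → ℝ → ℝ} (hW0 : MemLp (W 0) 2 symVol)
    (hW : ∀ j < r, HasPeriodicWeakDeriv (W j) (W (j + 1))) (heven : ∀ x, W 0 (-x) = W 0 x)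
    (K : ℕ) : ∃ b : Fin K → ℝ, ∀ m ≤ r,
      (K : ℝ) ^ (2 * (r - m)) * ∫ x, (W m x - iteratedDeriv m (cosSum b) x) ^ 2 ∂symVol ≤
        ∫ x, W r x ^ 2 ∂symVol := by
  have hmem : ∀ m ≤ r, MemLp (W m) 2 symVol
    | 0, _ => hW0
    | m + 1, hm => (hW m hm).memLp_deriv
  obtain ⟨b, hb⟩ := exists_energy_sub_cosSum_eq hW0 heven K
  refine ⟨b, fun m hm => mul_integral_sq_le_of_energy_le ((hmem m hm).sub (memLp_Ioo_of_continuous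
    (contDiff_iteratedDeriv (contDiff_cosSum b) m).continuous)) (hmem r le_rfl) fun n => ?_⟩
  have herror : energy (W m - iteratedDeriv m (cosSum b)) n =
      ((Real.pi * n) ^ 2) ^ m * if n.natAbs < K then 0 else energy (W 0) n := by
    rw [← hb, ← iteratedDeriv_zero (f := cosSum b)]
    exact energy_eq_of_chain (W := fun j x => W j x - iteratedDeriv j (cosSum b) x)
      (fun j hj => (hW j (hj.trans_le hm)).sub (hasPeriodicWeakDeriv_iteratedDeriv_cosSum b j)) n
  rw [herror]
  split_ifs with hn
  · simpa using energy_nonneg (W r) n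
  · have hKn : (K : ℝ) ^ 2 ≤ (Real.pi * n) ^ 2 := by
      have hK : (K : ℝ) ≤ |(n : ℝ)| := by
        rw [← Int.cast_abs, Int.abs_eq_natAbs]
        exact_mod_cast not_lt.1 hn
      rw [← sq_abs (Real.pi * n), abs_mul, abs_of_pos Real.pi_pos]
      gcongr
      nlinarith [Real.pi_gt_three, abs_nonneg (n : ℝ)]
    calc (K : ℝ) ^ (2 * (r - m)) * (((Real.pi * n) ^ 2) ^ m * energy (W 0) n)
        = ((K : ℝ) ^ 2) ^ (r - m) * (((Real.pi * n) ^ 2) ^ m * energy (W 0) n) := by rw [pow_mul]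
      _ ≤ ((Real.pi * n) ^ 2) ^ (r - m) * (((Real.pi * n) ^ 2) ^ m * energy (W 0) n) := by
          have := energy_nonneg (W 0) n
          gcongr
      _ = energy (W r) n := by
          rw [energy_eq_of_chain hW, ← mul_assoc, ← pow_add, Nat.sub_add_cancel hm]

end CosineApproximation

section Cutoff

variable {ε x : ℝ}

/-- A smooth step from `0` on `(-∞, 1/2]` to `1` on `[1, ∞)`. -/
def smoothStep (y : ℝ) : ℝ := Real.smoothTransition (2 * y - 1)

lemma contDiff_smoothStep : ContDiff ℝ ∞ smoothStep :=
  Real.smoothTransition.contDiff.comp (by fun_prop)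

lemma smoothStep_of_le_half {y : ℝ} (hy : y ≤ 1 / 2) : smoothStep y = 0 :=
  Real.smoothTransition.zero_of_nonpos (by linarith)

lemma smoothStep_of_one_le {y : ℝ} (hy : 1 ≤ y) : smoothStep y = 1 :=
  Real.smoothTransition.one_of_one_le (by linarith)

lemma support_deriv_smoothStep_subset : Function.support (deriv smoothStep) ⊆ Icc 0 1 := by
  refine Function.support_subset_iff'.2 fun y hy => ?_
  rcases not_and_or.1 hy with h0 | h1
  · have hconst : smoothStep =ᶠ[nhds y] fun _ => 0 :=
      Filter.eventuallyEq_of_mem (Iio_mem_nhds (not_le.1 h0)) fun z hz =>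
        smoothStep_of_le_half (by linarith [mem_Iio.1 hz])
    rw [hconst.deriv_eq, deriv_const]
  · have hconst : smoothStep =ᶠ[nhds y] fun _ => 1 :=
      Filter.eventuallyEq_of_mem (Ioi_mem_nhds (not_le.1 h1)) fun z hz =>
        smoothStep_of_one_le (mem_Ioi.1 hz).le
    rw [hconst.deriv_eq, deriv_const]

lemma exists_abs_iteratedDeriv_smoothStep_le (i : ℕ) :
    ∃ B, ∀ y, |iteratedDeriv i smoothStep y| ≤ B := by
  cases i with
  | zero =>
    refine ⟨1, fun y => ?_⟩
    rw [iteratedDeriv_zero, smoothStep, abs_of_nonneg (Real.smoothTransition.nonneg _)]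
    exact Real.smoothTransition.le_one _
  | succ i =>
    have hcompact : HasCompactSupport (deriv smoothStep) :=
      .of_support_subset_isCompact isCompact_Icc support_deriv_smoothStep_subset
    rw [iteratedDeriv_succ']
    refine Continuous.bounded_above_of_compact_support ?_
      (hcompact.of_isClosed_subset (isClosed_tsupport _) (tsupport_iteratedDeriv_subset i _))
    rw [← iteratedDeriv_succ']
    exact (contDiff_iteratedDeriv contDiff_smoothStep _).continuous

lemma iteratedDeriv_comp_affine {f : ℝ → ℝ} (i : ℕ) (hf : ContDiff ℝ i f) (c e : ℝ) :
    iteratedDeriv i (fun x => f (c * x + e)) = fun x => c ^ i * iteratedDeriv i f (c * x + e) := by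
  have hshift : ContDiff ℝ i fun z => f (z + e) := hf.comp (by fun_prop)
  have h := iteratedDeriv_comp_const_mul hshift c
  rwa [iteratedDeriv_comp_add_const] at h

/-- The even cutoff which is `1` on `[-(1 - ε), 1 - ε]` and vanishes within `ε / 2` of `±1`. It is
written as a sum rather than a product of two steps, so that its derivatives are explicit. -/
def cutoff (ε x : ℝ) : ℝ := smoothStep (ε⁻¹ * x + ε⁻¹) + smoothStep (-ε⁻¹ * x + ε⁻¹) - 1

lemma contDiff_cutoff (ε : ℝ) : ContDiff ℝ ∞ (cutoff ε) :=
  ((contDiff_smoothStep.comp (by fun_prop)).add (contDiff_smoothStep.comp (by fun_prop))).sub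
    contDiff_const

lemma cutoff_neg (ε x : ℝ) : cutoff ε (-x) = cutoff ε x := by
  simp only [cutoff, mul_neg, neg_mul, neg_neg, add_comm]

lemma cutoff_of_abs_le (hε : 0 < ε) (hx : |x| ≤ 1 - ε) : cutoff ε x = 1 := by
  obtain ⟨hx1, hx2⟩ := abs_le.1 hx
  have hstep : ∀ y, -(1 - ε) ≤ y → smoothStep (ε⁻¹ * y + ε⁻¹) = 1 := fun y hy =>
    smoothStep_of_one_le <| by
      calc 1 = ε⁻¹ * ε := (inv_mul_cancel₀ hε.ne').symm
        _ ≤ ε⁻¹ * (y + 1) := by gcongr; linarith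
        _ = ε⁻¹ * y + ε⁻¹ := by ring
  rw [cutoff, hstep x hx1, neg_mul_comm, hstep (-x) (by linarith)]
  ring

lemma cutoff_of_le (hε : ε ∈ Ioc (0 : ℝ) 1) (hx : 1 - ε / 2 ≤ x) : cutoff ε x = 0 := by
  have hε0 := hε.1
  have hx0 : 0 ≤ ε⁻¹ * x := mul_nonneg (inv_nonneg.2 hε0.le) (by linarith [hε.2])
  have hright : -ε⁻¹ * x + ε⁻¹ ≤ 1 / 2 :=
    calc -ε⁻¹ * x + ε⁻¹ = ε⁻¹ * (1 - x) := by ring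
      _ ≤ ε⁻¹ * (ε / 2) := by gcongr; linarith
      _ = 1 / 2 := by field_simp
  rw [cutoff, smoothStep_of_one_le (by linarith [(one_le_inv₀ hε0).2 hε.2]),
    smoothStep_of_le_half hright]
  ring

lemma tsupport_cutoff_subset (hε : ε ∈ Ioc (0 : ℝ) 1) : tsupport (cutoff ε) ⊆ Ioo (-1) 1 := by
  have hsupport : Function.support (cutoff ε) ⊆ Icc (-(1 - ε / 2)) (1 - ε / 2) := by
    refine Function.support_subset_iff'.2 fun x hx => ?_
    rcases not_and_or.1 hx with h | h
    · rw [← cutoff_neg]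
      exact cutoff_of_le hε (by linarith)
    · exact cutoff_of_le hε (not_le.1 h).le
  exact (closure_minimal hsupport isClosed_Icc).trans
    (Icc_subset_Ioo (by linarith [hε.1]) (by linarith [hε.1]))

lemma iteratedDeriv_cutoff (i : ℕ) (ε x : ℝ) : iteratedDeriv i (cutoff ε) x =
    ε⁻¹ ^ i * iteratedDeriv i smoothStep (ε⁻¹ * x + ε⁻¹) +
      (-ε⁻¹) ^ i * iteratedDeriv i smoothStep (-ε⁻¹ * x + ε⁻¹) - if i = 0 then 1 else 0 := by
  have hstep : ContDiff ℝ i smoothStep := contDiff_smoothStep.of_le (by exact_mod_cast le_top)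
  have hleft : ContDiff ℝ i fun x => smoothStep (ε⁻¹ * x + ε⁻¹) := hstep.comp (by fun_prop)
  have hright : ContDiff ℝ i fun x => smoothStep (-ε⁻¹ * x + ε⁻¹) := hstep.comp (by fun_prop)
  unfold cutoff
  rw [iteratedDeriv_fun_sub (hleft.add hright).contDiffAt contDiffAt_const,
    iteratedDeriv_fun_add hleft.contDiffAt hright.contDiffAt, iteratedDeriv_comp_affine i hstep,
    iteratedDeriv_comp_affine i hstep, iteratedDeriv_const]

lemma exists_abs_iteratedDeriv_cutoff_le (i : ℕ) :
    ∃ B, ∀ ε ∈ Ioc (0 : ℝ) 1, ∀ x, |iteratedDeriv i (cutoff ε) x| ≤ B * ε⁻¹ ^ i := by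
  obtain ⟨B, hB⟩ := exists_abs_iteratedDeriv_smoothStep_le i
  refine ⟨2 * B + 1, fun ε hε x => ?_⟩
  have hinv : (1 : ℝ) ≤ ε⁻¹ ^ i := one_le_pow₀ ((one_le_inv₀ hε.1).2 hε.2)
  have hterm : ∀ c y, |c| = ε⁻¹ → |c ^ i * iteratedDeriv i smoothStep y| ≤ ε⁻¹ ^ i * B :=
    fun c y hc => by
      rw [abs_mul, abs_pow, hc]
      exact mul_le_mul_of_nonneg_left (hB y) (zero_le_one.trans hinv)
  have habs : |ε⁻¹| = ε⁻¹ := abs_of_pos (inv_pos.2 hε.1)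
  have hconst : |(if i = 0 then 1 else 0 : ℝ)| ≤ 1 := by split_ifs <;> simp
  rw [iteratedDeriv_cutoff]
  calc _ ≤ ε⁻¹ ^ i * B + ε⁻¹ ^ i * B + 1 :=
        (abs_sub _ _).trans (add_le_add ((abs_add_le _ _).trans
          (add_le_add (hterm _ _ habs) (hterm _ _ ((abs_neg _).trans habs)))) hconst)
    _ ≤ (2 * B + 1) * ε⁻¹ ^ i := by linarith

end Cutoff

section SobolevChain

variable {a b : ℝ} {k r : ℕ} {u v w : ℝ → ℝ}

lemma HasWeakDeriv.succ (hv : HasWeakDeriv a b k u v) (hw : HasWeakDeriv a b (k + 1) u w) :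
    HasWeakDeriv a b 1 v w := by
  refine ⟨hv.2.1, hw.2.1, fun φ hφ hφc hφs => ?_⟩
  have hφ' : ContDiff ℝ ∞ (deriv φ) := ContDiff.iterate_deriv 1 hφ
  have hvφ := hv.2.2 (deriv φ) hφ' hφc.deriv (tsupport_deriv_subset.trans hφs)
  have hwφ := hw.2.2 φ hφ hφc hφs
  rw [iteratedDeriv_succ', hvφ, pow_succ, mul_assoc] at hwφ
  rw [iteratedDeriv_one, pow_one]
  exact mul_left_cancel₀ (pow_ne_zero k (by norm_num)) hwφ

lemma MemSobolev.exists_chain (h : MemSobolev a b r u) : ∃ v : ℕ → ℝ → ℝ, v 0 = u ∧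
    (∀ m ≤ r, MemLp (v m) 2 (volume.restrict (Ioo a b))) ∧
    ∀ m < r, HasL2WeakDeriv a b (v m) (v (m + 1)) := by
  choose! w hw using h.2
  have hu : LocallyIntegrableOn u (Ioo a b) := locallyIntegrableOn_of_memLp one_le_two h.1
  obtain ⟨v, hv0, hv⟩ : ∃ v : ℕ → ℝ → ℝ, v 0 = u ∧
      ∀ m ≤ r, MemLp (v m) 2 (volume.restrict (Ioo a b)) ∧ HasWeakDeriv a b m u (v m) := by
    refine ⟨fun m => if m = 0 then u else w m, if_pos rfl, fun m hm => ?_⟩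
    rcases eq_or_ne m 0 with rfl | hm0
    · exact ⟨h.1, hu, hu, fun φ _ _ _ => by simp⟩
    · simpa only [if_neg hm0] using hw m hm
  exact ⟨v, hv0, fun m hm => (hv m hm).1, fun m hm => ⟨(hv m hm.le).1, (hv (m + 1) hm).1,
    (hv m hm.le).2.succ (hv (m + 1) hm).2⟩⟩

end SobolevChain

section Leibniz

variable {η χ : ℝ → ℝ} {v : ℕ → ℝ → ℝ} {m : ℕ}

lemma HasL2WeakDeriv.hasPeriodicWeakDeriv_mul {u u' : ℝ → ℝ} (h : HasL2WeakDeriv (-1) 1 u u')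
    (hη : ContDiff ℝ ∞ η) (hηs : tsupport η ⊆ Ioo (-1) 1) :
    HasPeriodicWeakDeriv (fun x => η x * u x) (fun x => deriv η x * u x + η x * u' x) := by
  have hη' := hη.continuous_deriv (by simp)
  have hηu := memLp_continuous_mul h.memLp hη.continuous
  have hηu' := memLp_continuous_mul h.memLp_deriv hη.continuous
  have hη'u := memLp_continuous_mul h.memLp hη'
  refine ⟨hηu, hη'u.add hηu', fun φ hφ _ => ?_⟩
  have hφ' := hφ.continuous_deriv (by simp)
  have hηc : HasCompactSupport η :=
    isCompact_Icc.of_isClosed_subset (isClosed_tsupport _) (hηs.trans Ioo_subset_Icc_self)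
  have hd : ∀ x, deriv (fun x => η x * φ x) x = deriv η x * φ x + η x * deriv φ x := fun x =>
    deriv_fun_mul (hη.differentiable (by simp)).differentiableAt
      (hφ.differentiable (by simp)).differentiableAt
  have htest := h.integral_mul_deriv (hη.mul hφ) hηc.mul_right
    ((tsupport_mul_subset_left).trans hηs)
  have h_int : Integrable (fun x => η x * u x * deriv φ x) symVol :=
    integrable_mul_of_continuous hηu hφ'
  have h_int' : Integrable (fun x => deriv η x * u x * φ x) symVol :=
    integrable_mul_of_continuous hη'u hφ.continuous
  have h_int_deriv : Integrable (fun x => η x * u' x * φ x) symVol :=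
    integrable_mul_of_continuous hηu' hφ.continuous
  have hleft : ∫ x, u x * deriv (fun x => η x * φ x) x ∂symVol =
      (∫ x, deriv η x * u x * φ x ∂symVol) + ∫ x, η x * u x * deriv φ x ∂symVol := by
    rw [← integral_add h_int' h_int]
    exact integral_congr_ae (ae_of_all _ fun x => by simp only [hd]; ring)
  have hright : ∫ x, u' x * (η x * φ x) ∂symVol = ∫ x, η x * u' x * φ x ∂symVol :=
    integral_congr_ae (ae_of_all _ fun x => by ring)
  simp only [add_mul]
  rw [integral_add h_int' h_int_deriv]
  linarith

/-- The `m`-th derivative of `χ * v 0` according to Leibniz' rule, where `v j` stands for the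
`j`-th derivative of `v 0`. -/
def leibniz (χ : ℝ → ℝ) (v : ℕ → ℝ → ℝ) (m : ℕ) (x : ℝ) : ℝ :=
  ∑ ij ∈ Finset.HasAntidiagonal.antidiagonal m,
    (m.choose ij.1 : ℝ) * (iteratedDeriv ij.1 χ x * v ij.2 x)

lemma leibniz_zero (χ : ℝ → ℝ) (v : ℕ → ℝ → ℝ) (x : ℝ) : leibniz χ v 0 x = χ x * v 0 x := by
  simp [leibniz]

lemma leibniz_eq_of_eventuallyEq_one {x : ℝ} (h : χ =ᶠ[nhds x] fun _ => 1) :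
    leibniz χ v m x = v m x := by
  rw [leibniz, Finset.sum_eq_single (0, m)]
  · simp [h.eq_of_nhds]
  · rintro ⟨i, j⟩ hij hne
    have hi : i ≠ 0 := by
      rintro rfl
      exact hne (by simpa using hij)
    rw [h.iteratedDeriv_eq, iteratedDeriv_const, if_neg hi, zero_mul, mul_zero]
  · simp

lemma hasPeriodicWeakDeriv_leibniz (hχ : ContDiff ℝ ∞ χ) (hχs : tsupport χ ⊆ Ioo (-1) 1)
    (hv : ∀ j ≤ m, HasL2WeakDeriv (-1) 1 (v j) (v (j + 1))) :
    HasPeriodicWeakDeriv (leibniz χ v m) (leibniz χ v (m + 1)) := by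
  have hsucc : leibniz χ v (m + 1) = fun x => ∑ ij ∈ Finset.HasAntidiagonal.antidiagonal m,
      (m.choose ij.1 : ℝ) *
        (iteratedDeriv (ij.1 + 1) χ x * v ij.2 x + iteratedDeriv ij.1 χ x * v (ij.2 + 1) x) := by
    ext x
    rw [leibniz, Finset.sum_antidiagonal_choose_succ_mul (fun i j => iteratedDeriv i χ x * v j x),
      ← Finset.sum_add_distrib]
    refine Finset.sum_congr rfl fun ij hij => ?_
    rw [← Nat.choose_symm_of_eq_add (Finset.HasAntidiagonal.mem_antidiagonal.1 hij).symm]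
    ring
  rw [hsucc]
  refine .sum fun ij hij => .const_mul ?_ _
  rw [iteratedDeriv_succ]
  exact (hv ij.2 (Finset.HasAntidiagonal.antidiagonal.snd_le hij)).hasPeriodicWeakDeriv_mul
    (contDiff_iteratedDeriv hχ ij.1) ((tsupport_iteratedDeriv_subset ij.1 χ).trans hχs)

lemma memLp_leibniz (hχ : ContDiff ℝ ∞ χ) (hv : ∀ j ≤ m, MemLp (v j) 2 symVol) :
    MemLp (leibniz χ v m) 2 symVol :=
  memLp_finsetSum _ fun ij hij =>
    (memLp_continuous_mul (hv ij.2 (Finset.HasAntidiagonal.antidiagonal.snd_le hij))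
      (contDiff_iteratedDeriv hχ ij.1).continuous).const_mul _

lemma integral_sq_le_of_abs_le {α : Type*} [MeasurableSpace α] {μ : Measure α} {g V : α → ℝ}
    (hV : MemLp V 2 μ) {c : ℝ} (h : ∀ x, |g x| ≤ c * V x) :
    ∫ x, g x ^ 2 ∂μ ≤ c ^ 2 * ∫ x, V x ^ 2 ∂μ := by
  rw [← integral_const_mul]
  refine integral_mono_of_nonneg (ae_of_all _ fun x => sq_nonneg _)
    (hV.integrable_sq.const_mul _) (ae_of_all _ fun x => ?_)
  calc g x ^ 2 ≤ (c * V x) ^ 2 := sq_le_sq.2 ((h x).trans (le_abs_self _))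
    _ = c ^ 2 * V x ^ 2 := mul_pow _ _ _

lemma exists_integral_sq_leibniz_cutoff_le (hv : ∀ j ≤ m, MemLp (v j) 2 symVol) :
    ∃ C, 0 ≤ C ∧ ∀ ε ∈ Ioc (0 : ℝ) 1,
      ∫ x, leibniz (cutoff ε) v m x ^ 2 ∂symVol ≤ C * ε⁻¹ ^ (2 * m) := by
  choose B hB using exists_abs_iteratedDeriv_cutoff_le
  set V : ℝ → ℝ := fun x =>
    ∑ ij ∈ Finset.HasAntidiagonal.antidiagonal m, (m.choose ij.1 : ℝ) * (B ij.1 * |v ij.2 x|)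
  have hV : MemLp V 2 symVol := memLp_finsetSum _ fun ij hij =>
    ((hv ij.2 (Finset.HasAntidiagonal.antidiagonal.snd_le hij)).abs.const_mul _).const_mul _
  refine ⟨∫ x, V x ^ 2 ∂symVol, integral_nonneg fun _ => sq_nonneg _, fun ε hε => ?_⟩
  have hinv : 1 ≤ ε⁻¹ := (one_le_inv₀ hε.1).2 hε.2
  have hB0 : ∀ i, 0 ≤ B i := fun i => by
    simpa using (abs_nonneg _).trans (hB i 1 (by simp) 0)
  have hbound : ∀ x, |leibniz (cutoff ε) v m x| ≤ ε⁻¹ ^ m * V x := fun x => by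
    rw [leibniz, Finset.mul_sum]
    refine (Finset.abs_sum_le_sum_abs _ _).trans (Finset.sum_le_sum fun ij hij => ?_)
    have hB' : |iteratedDeriv ij.1 (cutoff ε) x| ≤ ε⁻¹ ^ m * B ij.1 := by
      rw [mul_comm]
      refine (hB _ ε hε x).trans ?_
      have := hB0 ij.1
      gcongr
      exact Finset.HasAntidiagonal.antidiagonal.fst_le hij
    rw [abs_mul, abs_mul, Nat.abs_cast, mul_left_comm (ε⁻¹ ^ m), ← mul_assoc (ε⁻¹ ^ m)]
    gcongr
  calc _ ≤ (ε⁻¹ ^ m) ^ 2 * ∫ x, V x ^ 2 ∂symVol := integral_sq_le_of_abs_le hV hbound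
    _ = _ := by rw [← pow_mul, mul_comm m, mul_comm]

end Leibniz

section ErrorBounds

variable {d r m : ℕ} {ε : ℝ}

lemma unitVol_le_symVol : unitVol ≤ symVol :=
  Measure.restrict_mono (Ioo_subset_Ioo (by norm_num) le_rfl) le_rfl

lemma integral_sq_unitVol_le {g : ℝ → ℝ} (hg : MemLp g 2 symVol) :
    ∫ x, g x ^ 2 ∂unitVol ≤ ∫ x, g x ^ 2 ∂symVol :=
  integral_mono_measure unitVol_le_symVol (ae_of_all _ fun _ => sq_nonneg _) hg.integrable_sq

lemma integral_sub_sq_le {α : Type*} [MeasurableSpace α] {μ : Measure α} {g h : α → ℝ}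
    (hg : MemLp g 2 μ) (hh : MemLp h 2 μ) :
    ∫ x, (g x - h x) ^ 2 ∂μ ≤ 2 * ∫ x, g x ^ 2 ∂μ + 2 * ∫ x, h x ^ 2 ∂μ := by
  have hg2 := hg.integrable_sq.const_mul 2
  have hh2 := hh.integrable_sq.const_mul 2
  rw [← integral_const_mul, ← integral_const_mul, ← integral_add hg2 hh2]
  refine integral_mono (hg.sub hh).integrable_sq (hg2.add hh2) fun x => ?_
  change (g x - h x) ^ 2 ≤ 2 * g x ^ 2 + 2 * h x ^ 2
  nlinarith [sq_nonneg (g x + h x)]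

lemma integral_sq_dilAvg_momentDensity_le (hd : 3 ≤ d) (m : ℕ) {g : ℝ → ℝ}
    (hg : MemLp g 2 unitVol) (hε : ε ∈ Ioc (0 : ℝ) 1) (hg0 : ∀ x ∈ Ioo 0 (1 - ε), g x = 0) :
    ∫ s, dilAvg (momentDensity d m) g s ^ 2 ∂unitVol ≤
      normConst d ^ 2 * (2 * ε) ^ (d - 1) * ∫ x, g x ^ 2 ∂unitVol := by
  have h2ε : 0 ≤ 2 * ε := by linarith [hε.1]
  refine (integral_dilAvg_sq_le (continuous_momentDensity hd m) hg hε.1 hε.2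
    (fun t ht => abs_momentDensity_le hd m hε.2 ht) hg0).trans_eq ?_
  obtain ⟨D, rfl⟩ : ∃ D, d = D + 3 := ⟨d - 3, by omega⟩
  have hpow : ((2 * ε) ^ ((((D + 3 : ℕ) : ℝ) - 3) / 2)) ^ 2 = (2 * ε) ^ D := by
    rw [← Real.rpow_natCast (_ ^ _), ← Real.rpow_mul h2ε, ← Real.rpow_natCast]
    congr 1
    push_cast
    ring
  rw [mul_pow, mul_pow, mul_pow, hpow, show D + 3 - 1 = D + 2 by omega]
  ring

lemma integral_sq_dilAvg_momentDensity_sub_le (hd : 3 ≤ d) (m : ℕ) {g h k : ℝ → ℝ}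
    (hg : MemLp g 2 unitVol) (hh : MemLp h 2 unitVol) (hk : MemLp k 2 unitVol)
    (hε : ε ∈ Ioc (0 : ℝ) 1) (hhg : ∀ x ∈ Ioo 0 (1 - ε), h x = g x) :
    ∫ s, (dilAvg (momentDensity d m) k s - dilAvg (momentDensity d m) g s) ^ 2 ∂unitVol ≤
      2 * normConst d ^ 2 * 2 ^ (d - 1) *
        (∫ x, (h x - k x) ^ 2 ∂unitVol + ε ^ (d - 1) * ∫ x, (h x - g x) ^ 2 ∂unitVol) := by
  have hw := continuous_momentDensity hd m
  have hsplit : ∀ s ∈ Ioo (0 : ℝ) 1,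
      (dilAvg (momentDensity d m) k s - dilAvg (momentDensity d m) g s) ^ 2 =
        (dilAvg (momentDensity d m) (fun x => h x - g x) s -
          dilAvg (momentDensity d m) (fun x => h x - k x) s) ^ 2 := fun s hs => by
    have h_int := fun {f : ℝ → ℝ} (hf : MemLp f 2 unitVol) => hf.integrable one_le_two
    rw [dilAvg_sub hw (h_int hh) (h_int hg) hs, dilAvg_sub hw (h_int hh) (h_int hk) hs]
    ring
  have hnear := integral_sq_dilAvg_momentDensity_le hd m (hh.sub hg) hε
    fun x hx => sub_eq_zero.2 (hhg x hx)
  have hall := integral_sq_dilAvg_momentDensity_le hd m (hh.sub hk) (ε := 1) (by simp) (by simp)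
  rw [setIntegral_congr_fun measurableSet_Ioo hsplit]
  refine (integral_sub_sq_le (memLp_dilAvg hw (hh.sub hg)) (memLp_dilAvg hw (hh.sub hk))).trans ?_
  simp only [Pi.sub_apply] at hnear hall
  rw [mul_pow] at hnear
  rw [mul_one] at hall
  linarith

lemma leibniz_cutoff_eq (hε : 0 < ε) (v : ℕ → ℝ → ℝ) (m : ℕ) {x : ℝ} (hx : x ∈ Ioo 0 (1 - ε)) :
    leibniz (cutoff ε) v m x = v m x := by
  refine leibniz_eq_of_eventuallyEq_one ?_
  filter_upwards [isOpen_Ioo.mem_nhds hx] with y hy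
  exact cutoff_of_abs_le hε (by rw [abs_of_pos hy.1]; exact hy.2.le)

lemma exists_integral_sq_leibniz_cutoff_sub_le {v : ℕ → ℝ → ℝ}
    (hv : ∀ m ≤ r, MemLp (v m) 2 symVol) :
    ∃ C, 0 ≤ C ∧ ∀ ε ∈ Ioc (0 : ℝ) 1, ∀ m ≤ r,
      ∫ x, (leibniz (cutoff ε) v m x - v m x) ^ 2 ∂symVol ≤ C * ε⁻¹ ^ (2 * m) := by
  have hv' : ∀ m ≤ r, ∀ j ≤ m, MemLp (v j) 2 symVol := fun m hm j hj => hv j (hj.trans hm)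
  choose! A hA0 hA using fun m hm => exists_integral_sq_leibniz_cutoff_le (hv' m hm)
  set B : ℕ → ℝ := fun m => 2 * A m + 2 * ∫ x, v m x ^ 2 ∂symVol
  have hV : ∀ m, 0 ≤ ∫ x, v m x ^ 2 ∂symVol := fun m => integral_nonneg fun _ => sq_nonneg _
  have hB0 : ∀ m ∈ Finset.range (r + 1), 0 ≤ B m := fun m hm => by
    linarith [hA0 m (Finset.mem_range_succ_iff.1 hm), hV m]
  refine ⟨∑ m ∈ Finset.range (r + 1), B m, Finset.sum_nonneg hB0, fun ε hε m hm => ?_⟩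
  have hpow : 1 ≤ ε⁻¹ ^ (2 * m) := one_le_pow₀ ((one_le_inv₀ hε.1).2 hε.2)
  calc ∫ x, (leibniz (cutoff ε) v m x - v m x) ^ 2 ∂symVol
      ≤ 2 * ∫ x, leibniz (cutoff ε) v m x ^ 2 ∂symVol + 2 * ∫ x, v m x ^ 2 ∂symVol :=
        integral_sub_sq_le (memLp_leibniz (contDiff_cutoff ε) (hv' m hm)) (hv m hm)
    _ ≤ B m * ε⁻¹ ^ (2 * m) := by
        linarith [hA m hm ε hε, mul_le_mul_of_nonneg_left hpow (hV m)]
    _ ≤ (∑ m ∈ Finset.range (r + 1), B m) * ε⁻¹ ^ (2 * m) := by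
        have := Finset.single_le_sum hB0 (Finset.mem_range_succ_iff.2 hm)
        gcongr

lemma exists_cosSum_approx_leibniz_cutoff {v : ℕ → ℝ → ℝ} (hv2 : ∀ m ≤ r, MemLp (v m) 2 symVol)
    (hv : ∀ m < r, HasL2WeakDeriv (-1) 1 (v m) (v (m + 1))) (heven : ∀ x, v 0 (-x) = v 0 x) :
    ∃ C, 0 ≤ C ∧ ∀ K : ℕ, 1 ≤ K → ∀ ε ∈ Ioc (0 : ℝ) 1, ∃ b : Fin K → ℝ, ∀ m ≤ r,
      ∫ x, (leibniz (cutoff ε) v m x - iteratedDeriv m (cosSum b) x) ^ 2 ∂symVol ≤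
        C * (ε⁻¹ ^ (2 * r) / K ^ (2 * (r - m))) := by
  obtain ⟨C, hC0, hC⟩ := exists_integral_sq_leibniz_cutoff_le hv2
  refine ⟨C, hC0, fun K hK ε hε => ?_⟩
  obtain ⟨b, hb⟩ := exists_cosSum_approx (W := leibniz (cutoff ε) v)
    (memLp_leibniz (contDiff_cutoff ε) fun j hj => hv2 j (hj.trans r.zero_le))
    (fun m hm => hasPeriodicWeakDeriv_leibniz (contDiff_cutoff ε) (tsupport_cutoff_subset hε)
      fun j hj => hv j (hj.trans_lt hm))
    (fun x => by simp only [leibniz_zero, cutoff_neg, heven]) K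
  refine ⟨b, fun m hm => ?_⟩
  have : (0 : ℝ) < K := by exact_mod_cast hK
  rw [← mul_div_assoc, le_div_iff₀' (by positivity)]
  exact (hb m hm).trans (hC ε hε)

/-- The trade-off behind the rate: cutting off at width `ε` costs `ε⁻¹ ^ r` in the highest
derivative, while the error made on the modified zone is damped by `ε ^ ((d - 1) / 2)`, because the
zone is small and the density decays there. -/
lemma exists_cosSum_dilAvg_approx (hd : 3 ≤ d) {v : ℕ → ℝ → ℝ}
    (hv2 : ∀ m ≤ r, MemLp (v m) 2 symVol)
    (hv : ∀ m < r, HasL2WeakDeriv (-1) 1 (v m) (v (m + 1))) (heven : ∀ x, v 0 (-x) = v 0 x) :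
    ∃ C, 0 < C ∧ ∀ K : ℕ, 1 ≤ K → ∀ ε ∈ Ioc (0 : ℝ) 1, ∃ b : Fin K → ℝ, ∀ m ≤ r,
      ∫ s, (dilAvg (momentDensity d m) (iteratedDeriv m (cosSum b)) s -
          dilAvg (momentDensity d m) (v m) s) ^ 2 ∂unitVol ≤
        C * (ε⁻¹ ^ (2 * r) / K ^ (2 * (r - m)) + ε ^ (d - 1) * ε⁻¹ ^ (2 * m)) := by
  obtain ⟨A, hA0, hA⟩ := exists_cosSum_approx_leibniz_cutoff hv2 hv heven
  obtain ⟨B, hB0, hB⟩ := exists_integral_sq_leibniz_cutoff_sub_le hv2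
  set Q := 2 * normConst d ^ 2 * 2 ^ (d - 1)
  have hQ : 0 < Q := by
    have := normConst_pos (d := d) (by omega)
    positivity
  refine ⟨Q * (A + B + 1), by positivity, fun K hK ε hε => ?_⟩
  obtain ⟨b, hb⟩ := hA K hK ε hε
  refine ⟨b, fun m hm => ?_⟩
  have hε0 := hε.1
  have hL : MemLp (leibniz (cutoff ε) v m) 2 symVol :=
    memLp_leibniz (contDiff_cutoff ε) fun j hj => hv2 j (hj.trans hm)
  have hcos : MemLp (iteratedDeriv m (cosSum b)) 2 symVol :=
    memLp_Ioo_of_continuous (contDiff_iteratedDeriv (contDiff_cosSum b) m).continuous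
  have hunit : ∀ {g : ℝ → ℝ}, MemLp g 2 symVol → MemLp g 2 unitVol := fun hg =>
    hg.mono_measure unitVol_le_symVol
  refine (integral_sq_dilAvg_momentDensity_sub_le hd m (hunit (hv2 m hm)) (hunit hL)
    (hunit hcos) hε fun x hx => leibniz_cutoff_eq hε0 v m hx).trans ?_
  calc _ ≤ Q * (A * (ε⁻¹ ^ (2 * r) / K ^ (2 * (r - m))) +
        ε ^ (d - 1) * (B * ε⁻¹ ^ (2 * m))) := by
        gcongr
        exacts [(integral_sq_unitVol_le (hL.sub hcos)).trans (hb m hm),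
          (integral_sq_unitVol_le (hL.sub (hv2 m hm))).trans (hB ε hε m hm)]
    _ ≤ Q * ((A + B + 1) * (ε⁻¹ ^ (2 * r) / K ^ (2 * (r - m))) +
        ε ^ (d - 1) * ((A + B + 1) * ε⁻¹ ^ (2 * m))) := by
        gcongr
        exacts [by linarith, by linarith]
    _ = _ := by ring

end ErrorBounds

section Rates

variable {d r : ℕ} {u F : ℝ → ℝ}

/-- The two terms balance at `ε = K ^ (-2 * p / (q + 2 * r))`. -/
lemma le_rpow_of_balance {N C : ℝ} (hC : 0 ≤ C) {K p q : ℕ} (hK : 1 ≤ K) (hqr : 0 < q + 2 * r)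
    (h : ∀ ε ∈ Ioc (0 : ℝ) 1, N ^ 2 ≤ C * (ε⁻¹ ^ (2 * r) / K ^ (2 * p) + ε ^ q)) :
    N ≤ √(2 * C) * (K : ℝ) ^ (-((p : ℝ) * q / (q + 2 * r))) := by
  have hK1 : (1 : ℝ) ≤ K := by exact_mod_cast hK
  have hK0 : (0 : ℝ) < K := by linarith
  have hqr' : (0 : ℝ) < q + 2 * r := by exact_mod_cast hqr
  set θ : ℝ := 2 * p / (q + 2 * r)
  have hθ : 0 ≤ θ := by positivity
  have hε : (K : ℝ) ^ (-θ) ∈ Ioc (0 : ℝ) 1 :=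
    ⟨by positivity, Real.rpow_le_one_of_one_le_of_nonpos hK1 (by linarith)⟩
  have htrunc : ((K : ℝ) ^ (-θ))⁻¹ ^ (2 * r) / (K : ℝ) ^ (2 * p) = (K : ℝ) ^ (-(θ * q)) := by
    rw [← Real.rpow_neg hK0.le, neg_neg, ← Real.rpow_natCast, ← Real.rpow_mul hK0.le,
      ← Real.rpow_natCast, ← Real.rpow_sub hK0]
    congr 1
    simp only [θ]
    push_cast
    field_simp
    ring
  have hcut : ((K : ℝ) ^ (-θ)) ^ q = (K : ℝ) ^ (-(θ * q)) := by
    rw [← Real.rpow_natCast, ← Real.rpow_mul hK0.le, neg_mul]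
  have hsq : ((K : ℝ) ^ (-((p : ℝ) * q / (q + 2 * r)))) ^ 2 = (K : ℝ) ^ (-(θ * q)) := by
    rw [← Real.rpow_natCast, ← Real.rpow_mul hK0.le]
    congr 1
    simp only [θ]
    push_cast
    field_simp
  have hbound := h _ hε
  rw [htrunc, hcut] at hbound
  refine le_of_abs_le (abs_le_of_sq_le_sq ?_ (by positivity))
  rw [mul_pow, Real.sq_sqrt (by positivity), hsq]
  linarith

lemma exists_l2Norm_sub_le (hd : 3 ≤ d) (hu : MemSobolev (-1) 1 r u)
    (heven : ∀ x, u (-x) = u x) (hF : F =ᵐ[unitVol] slicing d u) :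
    ∃ C, 0 < C ∧ ∀ K : ℕ, 1 ≤ K → ∀ a : Fin K → ℝ, IsMinimizer l2Norm d F a →
      l2Norm (fun s => F s - slicing d (cosSum a) s) ≤
        C * (K : ℝ) ^ (-((r : ℝ) / (1 + 2 * (r : ℝ) / ((d : ℝ) - 1)))) := by
  obtain ⟨v, rfl, hv2, hv⟩ := hu.exists_chain
  obtain ⟨C, hC, happrox⟩ := exists_cosSum_dilAvg_approx hd hv2 hv heven
  refine ⟨√(2 * C), by positivity, fun K hK a ha => ?_⟩
  have hexp : (r : ℝ) * ((d - 1 : ℕ) : ℝ) / (((d - 1 : ℕ) : ℝ) + 2 * r) =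
      r / (1 + 2 * r / ((d : ℝ) - 1)) := by
    have hd' : (3 : ℝ) ≤ d := by exact_mod_cast hd
    have : (d : ℝ) - 1 ≠ 0 := by linarith
    rw [Nat.cast_sub (by omega), Nat.cast_one]
    field_simp
  rw [← hexp]
  refine le_rpow_of_balance hC.le hK (by omega) fun ε hε => ?_
  obtain ⟨b, hb⟩ := happrox K hK ε hε
  calc l2Norm (fun s => F s - slicing d (cosSum a) s) ^ 2
      = l2Norm (fun s => slicing d (cosSum a) s - F s) ^ 2 := by
        simp only [sq_l2Norm, sub_sq_comm (F _)]
    _ ≤ l2Norm (fun s => slicing d (cosSum b) s - F s) ^ 2 := ha b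
    _ = ∫ s, (slicing d (cosSum b) s - slicing d (v 0) s) ^ 2 ∂unitVol := by
        rw [sq_l2Norm]
        exact integral_congr_ae (hF.mono fun s hs => by simp only [hs])
    _ ≤ C * (ε⁻¹ ^ (2 * r) / K ^ (2 * r) + ε ^ (d - 1)) := by
        simpa [slicing_eq_dilAvg] using hb 0 r.zero_le

lemma hasL2WeakDeriv_of_ae_eq_slicing (hd : 3 ≤ d) {u' : ℝ → ℝ} (hu : HasL2WeakDeriv (-1) 1 u u')
    (hF : F =ᵐ[unitVol] slicing d u) :
    HasL2WeakDeriv 0 1 F (dilAvg (momentDensity d 1) u') :=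
  ((hu.mono (by norm_num) le_rfl).slicing hd).congr hF.symm .rfl

lemma sq_h1Norm_slicing_cosSum_sub (hd : 3 ≤ d) {u' : ℝ → ℝ} (hu : HasL2WeakDeriv (-1) 1 u u')
    (hF : F =ᵐ[unitVol] slicing d u) {K : ℕ} (b : Fin K → ℝ) :
    h1Norm (fun s => slicing d (cosSum b) s - F s) ^ 2 =
      (∫ s, (dilAvg (momentDensity d 0) (iteratedDeriv 0 (cosSum b)) s -
        dilAvg (momentDensity d 0) u s) ^ 2 ∂unitVol) +
      ∫ s, (dilAvg (momentDensity d 1) (iteratedDeriv 1 (cosSum b)) s -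
        dilAvg (momentDensity d 1) u' s) ^ 2 ∂unitVol := by
  rw [((hasL2WeakDeriv_slicing_cosSum hd b).sub
    (hasL2WeakDeriv_of_ae_eq_slicing hd hu hF)).sq_h1Norm, iteratedDeriv_zero, ← slicing_eq_dilAvg]
  congr 1
  exact integral_congr_ae (hF.mono fun s hs => by simp only [hs])

lemma exists_h1Norm_sub_le (hd : 3 ≤ d) (hr : 1 ≤ r) (hu : MemSobolev (-1) 1 r u)
    (heven : ∀ x, u (-x) = u x) (hF : F =ᵐ[unitVol] slicing d u) :
    ∃ C, 0 < C ∧ ∀ K : ℕ, 1 ≤ K → ∀ a : Fin K → ℝ, IsMinimizer h1Norm d F a →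
      h1Norm (fun s => F s - slicing d (cosSum a) s) ≤
        C * (K : ℝ) ^ (-(((r : ℝ) - 1) * ((d : ℝ) - 3) / ((d : ℝ) - 3 + 2 * (r : ℝ)))) := by
  obtain ⟨v, rfl, hv2, hv⟩ := hu.exists_chain
  obtain ⟨C, hC, happrox⟩ := exists_cosSum_dilAvg_approx hd hv2 hv heven
  have hFv := hasL2WeakDeriv_of_ae_eq_slicing hd (hv 0 hr) hF
  have hS := fun {K : ℕ} (a : Fin K → ℝ) => hasL2WeakDeriv_slicing_cosSum hd a
  refine ⟨√(2 * (2 * C)), by positivity, fun K hK a ha => ?_⟩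
  rw [← Nat.cast_pred hr, show (d : ℝ) - 3 = ((d - 3 : ℕ) : ℝ) by rw [Nat.cast_sub hd]; norm_num]
  refine le_rpow_of_balance (by positivity) hK (by omega) fun ε hε => ?_
  obtain ⟨b, hb⟩ := happrox K hK ε hε
  have hε0 := hε.1
  have hK1 : (1 : ℝ) ≤ K := by exact_mod_cast hK
  have hpow : ε ^ (d - 1) * ε⁻¹ ^ (2 * 1) = ε ^ (d - 3) := by
    rw [show d - 1 = d - 3 + 2 by omega, pow_add, mul_assoc, ← mul_pow, mul_inv_cancel₀ hε0.ne',
      one_pow, mul_one]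
  calc h1Norm (fun s => F s - slicing d (cosSum a) s) ^ 2
      = h1Norm (fun s => slicing d (cosSum a) s - F s) ^ 2 := by
        rw [(hFv.sub (hS a)).sq_h1Norm, ((hS a).sub hFv).sq_h1Norm]
        simp only [sub_sq_comm (F _), sub_sq_comm (dilAvg _ (v 1) _)]
    _ ≤ h1Norm (fun s => slicing d (cosSum b) s - F s) ^ 2 := ha b
    _ ≤ C * (ε⁻¹ ^ (2 * r) / K ^ (2 * (r - 0)) + ε ^ (d - 1) * ε⁻¹ ^ (2 * 0)) +
          C * (ε⁻¹ ^ (2 * r) / K ^ (2 * (r - 1)) + ε ^ (d - 1) * ε⁻¹ ^ (2 * 1)) :=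
        (sq_h1Norm_slicing_cosSum_sub hd (hv 0 hr) hF b).trans_le
          (add_le_add (hb 0 r.zero_le) (hb 1 hr))
    _ ≤ C * (ε⁻¹ ^ (2 * r) / K ^ (2 * (r - 1)) + ε ^ (d - 3)) +
          C * (ε⁻¹ ^ (2 * r) / K ^ (2 * (r - 1)) + ε ^ (d - 3)) := by
        rw [hpow, mul_zero, pow_zero, mul_one]
        have := pow_le_pow_of_le_one hε0.le hε.2 (show d - 3 ≤ d - 1 by omega)
        gcongr
        omega
    _ = 2 * C * (ε⁻¹ ^ (2 * r) / K ^ (2 * (r - 1)) + ε ^ (d - 3)) := by ring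

end Rates

end Slicing

end

theorem proposition5p4 (d : ℕ) (hd : 3 ≤ d) (r : ℕ) (hr : 1 ≤ r) (f F : ℝ → ℝ)
    (hf : Slicing.MemSobolev (-1) 1 r (fun x => f |x|))
    (hF : ∀ᵐ s ∂(volume.restrict (Set.Icc (0 : ℝ) 1)), F s = Slicing.slicing d f s) :
    (∃ C : ℝ, 0 < C ∧ ∀ K : ℕ, 1 ≤ K →
      (∃! a : Fin K → ℝ, Slicing.IsMinimizer Slicing.l2Norm d F a) ∧
      ∀ a : Fin K → ℝ, Slicing.IsMinimizer Slicing.l2Norm d F a →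
        MemLp (fun s => F s - Slicing.slicing d (Slicing.cosSum a) s) 2
          (volume.restrict (Set.Icc (0 : ℝ) 1)) ∧
        Slicing.l2Norm (fun s => F s - Slicing.slicing d (Slicing.cosSum a) s) ≤
          C * (K : ℝ) ^ (-((r : ℝ) / (1 + 2 * (r : ℝ) / ((d : ℝ) - 1))))) ∧
    (∃ C : ℝ, 0 < C ∧ ∀ K : ℕ, 1 ≤ K →
      (∃! a : Fin K → ℝ, Slicing.IsMinimizer Slicing.h1Norm d F a) ∧
      ∀ a : Fin K → ℝ, Slicing.IsMinimizer Slicing.h1Norm d F a →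
        Slicing.MemSobolev 0 1 1 (fun s => F s - Slicing.slicing d (Slicing.cosSum a) s) ∧
        Slicing.h1Norm (fun s => F s - Slicing.slicing d (Slicing.cosSum a) s) ≤
          C * (K : ℝ) ^ (-(((r : ℝ) - 1) * ((d : ℝ) - 3) / ((d : ℝ) - 3 + 2 * (r : ℝ))))) := by
  open Slicing in
  set u : ℝ → ℝ := fun x => f |x|
  have heven : ∀ x, u (-x) = u x := fun x => by simp only [u, abs_neg]
  have hFu : F =ᵐ[unitVol] slicing d u := by
    filter_upwards [ae_restrict_of_ae_restrict_of_subset Set.Ioo_subset_Icc_self hF,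
      ae_restrict_mem measurableSet_Ioo] with s hs hs'
    refine hs.trans (slicing_eq_dilAvg d ▸ dilAvg_congr ?_ hs')
    filter_upwards [ae_restrict_mem measurableSet_Ioo] with x hx
    simp only [u, abs_of_pos hx.1]
  obtain ⟨v, hvu, -, hv⟩ := hf.exists_chain
  have hFv := hasL2WeakDeriv_of_ae_eq_slicing hd (hvu ▸ hv 0 hr) hFu
  have hsub := fun {K : ℕ} (a : Fin K → ℝ) => hFv.sub (hasL2WeakDeriv_slicing_cosSum hd a)
  obtain ⟨C₁, hC₁, hrate₁⟩ := exists_l2Norm_sub_le hd hf heven hFu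
  obtain ⟨C₂, hC₂, hrate₂⟩ := exists_h1Norm_sub_le hd hr hf heven hFu
  refine ⟨⟨C₁, hC₁, fun K hK => ⟨existsUnique_isMinimizer_l2Norm hd hFv.memLp K, fun a ha =>
      ⟨?_, hrate₁ K hK a ha⟩⟩⟩,
    ⟨C₂, hC₂, fun K hK => ⟨existsUnique_isMinimizer_h1Norm hd hFv K, fun a ha =>
      ⟨(hsub a).memSobolev, hrate₂ K hK a ha⟩⟩⟩⟩
  rw [Measure.restrict_congr_set Ioo_ae_eq_Icc.symm]
  exact (hsub a).memLp
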